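/- There are universal constants $\underline C>0$, $C_0>0$ and a universal price interval $[\underline p,\overline p]\subseteq[0,1]$, $\underline p<\overline p$, such that the following holds for all integers $d\ge 1$, all $\varepsilon\in(0,1]$ and all $T\in\mathbb N$ with $$T\ \ge\ C_0\,\varepsilon^{-1}d^{d/2+1}\ln(d/\varepsilon)\qquad\text{and}\qquad T\ \ge\ \varepsilon^{-2}.$$ Setting. Let $\mathcal X=[0,1]^d$, let $P_X$ be the uniform distribution on $\mathcal X$, let $\{0,1\}\subseteq\mathcal Y\subseteq[0,1]$, let $\mathcal Z$ be a measurable space, and put $\mathcal S=\mathcal X\times\mathcal Y\times[\underline p,\overline p]$. A personalized pricing policy $\pi=\{Q_t,A_t\}$ consists of Markov kernels: at time $t$ a context $x_t\sim P_X$ arrives (i.i.d.), a price $p_t\sim A_t(\cdot\mid x_t,z_1,\dots,z_{t-1})$ in $[\underline p,\overline p]$ is offered, a demand $y_t\in\mathcal Y$ with $\mathbb E[y_t\mid x_t,p_t]=\lambda(p_t,x_t)$ is realized, and a statistic $z_t\sim Q_t(\cdot\mid s_t,z_1,\dots,z_{t-1})$ in $\mathcal Z$ is recorded, where $s_t=(x_t,y_t,p_t)$.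 The policy is $\varepsilon$-LDP if $Q_t(U\mid s,z_{<t})\le e^{\varepsilon}Q_t(U\mid s',z_{<t})$ for all $t\le T$, all $z_{<t}\in\mathcal Z^{t-1}$, all $s,s'\in\mathcal S$ and all measurable $U\subseteq\mathcal Z$. Claim. For every $\varepsilon$-LDP personalized pricing policy $\pi$ there is a demand model (a function $\lambda$ and a conditional law of $y_t$ given $(x_t,p_t)$ on $\mathcal Y$ with mean $\lambda(p_t,x_t)$) whose revenue function $f(p,x)=p\lambda(p,x)$ has pointwise maximizers $p^*(x)\in\arg\max_{p\in[\underline p,\overline p]}f(p,x)$ and satisfies, with $C_X=1$, $C_L=4$, $\sigma_H=\sqrt2$, $C_H=2$, $C_p=1$: (A1) $\mathcal X\subseteq[0,1]^d$, $\mathcal Y\subseteq[0,1]$, $[\underline p,\overline p]\subseteq[0,1]$, and $P_X$ has a density on $\mathcal X$ bounded by $C_X$; (A2) $|f(p,x)-f(p',x')|\le C_L(|p-p'|+\|x-x'\|_2)$ for all $p,p'\in[\underline p,\overline p]$, $x,x'\in\mathcal X$; (A3) for every axis-parallel hypercube $B\subseteq\mathcal X$ (of positive side length), the function $f_B(p)=\mathbb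 E_{P_X}[f(p,x)\mid x\in B]$ is twice continuously differentiable on $[\underline p,\overline p]$, has a maximizer $p^*(B)\in(\underline p,\overline p)$ over $[\underline p,\overline p]$, satisfies $\sigma_H^2\le -f_B''(p)\le C_H^2$ for $p\in(\underline p,\overline p)$, and $\inf_{x\in B}p^*(x)\le p^*(B)\le\sup_{x\in B}p^*(x)$ as well as $\sup_{x\in B}p^*(x)-\inf_{x\in B}p^*(x)\le C_p\sup_{x,x'\in B}\|x-x'\|_2$; and for which $$\mathbb E^{\pi}\Big[\sum_{t=1}^T f(p^*(x_t),x_t)-f(p_t,x_t)\Big]\ \ge\ \underline C\,\frac{\varepsilon^{-2/(d+2)}\,T^{(d+1)/(d+2)}}{d^{7/3}} .$$ -/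

import Mathlib

open MeasureTheory ProbabilityTheory

noncomputable section

namespace PrivatePricing

/-- Contexts are vectors of `ℝ^d` with the Euclidean norm. -/
abbrev Ctx (d : ℕ) := EuclideanSpace ℝ (Fin d)

/-- The unit cube `[0,1]^d`. -/
def unitCube (d : ℕ) : Set (Ctx d) := {x | ∀ i, x i ∈ Set.Icc (0 : ℝ) 1}

/-- The uniform distribution on `[0,1]^d`. -/
def uniformCube (d : ℕ) : Measure (Ctx d) := volume.restrict (unitCube d)

/-- The axis-parallel hypercube with lower corner `a` and side length `l`. -/
def hypercube {d : ℕ} (a : Ctx d) (l : ℝ) : Set (Ctx d) :=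
  {x | ∀ i, x i ∈ Set.Icc (a i) (a i + l)}

/-! ### Pricing policies and the interaction protocol -/

section Protocol

variable {𝒳 𝒴 𝓟 𝒵 : Type*} [MeasurableSpace 𝒳] [MeasurableSpace 𝒴]
  [MeasurableSpace 𝓟] [MeasurableSpace 𝒵]

/-- A personalized pricing policy which only remembers anonymized statistics. Periods are numbered
from `0`, so that `Fin t → 𝒵` is the space of anonymized statistics recorded before period `t`.
`Q t` is the statistics recorder: the law of `z_t` given the data `s_t = (x_t, y_t, p_t)` and
`z_{<t}`. `A t` is the pricing strategy: the law of `p_t` given `x_t` and `z_{<t}`. -/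
structure PricingPolicy (𝒳 𝒴 𝓟 𝒵 : Type*) [MeasurableSpace 𝒳] [MeasurableSpace 𝒴]
    [MeasurableSpace 𝓟] [MeasurableSpace 𝒵] where
  Q : (t : ℕ) → Kernel ((𝒳 × 𝒴 × 𝓟) × (Fin t → 𝒵)) 𝒵
  A : (t : ℕ) → Kernel (𝒳 × (Fin t → 𝒵)) 𝓟
  markovQ : ∀ t, IsMarkovKernel (Q t)
  markovA : ∀ t, IsMarkovKernel (A t)

/-- `ε`-local differential privacy over the first `T` periods. -/
def PricingPolicy.IsLDP (π : PricingPolicy 𝒳 𝒴 𝓟 𝒵) (T : ℕ) (ε : ℝ) : Prop :=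
  ∀ t < T, ∀ (z : Fin t → 𝒵) (s s' : 𝒳 × 𝒴 × 𝓟) (U : Set 𝒵), MeasurableSet U →
    π.Q t (s, z) U ≤ ENNReal.ofReal (Real.exp ε) * π.Q t (s', z) U

/-- The law of `s_t = (x_t, y_t, p_t)` given `z_{<t}`: the context has law `μ`, then
`p_t ∼ A_t(· | x_t, z_{<t})`, then the demand `y_t` has law `D (x_t, p_t)`. -/
def PricingPolicy.dataLaw (π : PricingPolicy 𝒳 𝒴 𝓟 𝒵) (μ : Measure 𝒳)
    (D : Kernel (𝒳 × 𝓟) 𝒴) (t : ℕ) : Kernel (Fin t → 𝒵) (𝒳 × 𝒴 × 𝓟) :=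
  ((Kernel.const (Fin t → 𝒵) μ ⊗ₖ (π.A t).comap Prod.swap measurable_swap) ⊗ₖ
    Kernel.prodMkLeft (Fin t → 𝒵) D).map
      (fun w : (𝒳 × 𝓟) × 𝒴 => (w.1.1, w.2, w.1.2))

/-- The law of `(s_t, z_t)` given `z_{<t}`. -/
def PricingPolicy.roundLaw (π : PricingPolicy 𝒳 𝒴 𝓟 𝒵) (μ : Measure 𝒳)
    (D : Kernel (𝒳 × 𝓟) 𝒴) (t : ℕ) : Kernel (Fin t → 𝒵) ((𝒳 × 𝒴 × 𝓟) × 𝒵) :=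
  π.dataLaw μ D t ⊗ₖ (π.Q t).comap Prod.swap measurable_swap

/-- The joint law of `(s_i, z_i)`, `i < t`, when the policy `π` is run with i.i.d. contexts of law
`μ` and demand kernel `D`. -/
def PricingPolicy.law (π : PricingPolicy 𝒳 𝒴 𝓟 𝒵) (μ : Measure 𝒳)
    (D : Kernel (𝒳 × 𝓟) 𝒴) : (t : ℕ) → Measure (Fin t → (𝒳 × 𝒴 × 𝓟) × 𝒵)
  | 0 => Measure.dirac Fin.elim0
  | t + 1 =>
    (π.law μ D t ⊗ₘ (π.roundLaw μ D t).comap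
        (fun (ω : Fin t → (𝒳 × 𝒴 × 𝓟) × 𝒵) (i : Fin t) => (ω i).2) (by fun_prop)).map
      (fun q => (Fin.snoc q.1 q.2 : Fin (t + 1) → (𝒳 × 𝒴 × 𝓟) × 𝒵))

end Protocol

/-! ### Demand models, assumptions, regret -/

/-- A demand model: a demand function `lam p x` together with a conditional law of the demand
given context and price, with values in `Y` and mean `lam p x`. -/
structure DemandModel {d : ℕ} (X : Set (Ctx d)) (Y : Set ℝ) (lo hi : ℝ) where
  lam : ℝ → Ctx d → ℝ
  D : Kernel (X × Set.Icc lo hi) Y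
  markovD : IsMarkovKernel D
  mean_eq : ∀ (x : X) (p : Set.Icc lo hi), ∫ y, (y : ℝ) ∂(D (x, p)) = lam p x

section Model

variable {d : ℕ} {X : Set (Ctx d)} {Y : Set ℝ} {lo hi : ℝ}

/-- Expected revenue `f(p, x) = p λ(p, x)`. -/
def DemandModel.rev (M : DemandModel X Y lo hi) (p : ℝ) (x : Ctx d) : ℝ := p * M.lam p x

/-- `pstar x` maximizes the revenue at context `x` over the prices in `[lo, hi]`. -/
def DemandModel.IsOptimalPrice (M : DemandModel X Y lo hi) (pstar : Ctx d → ℝ) : Prop :=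
  ∀ x ∈ X, pstar x ∈ Set.Icc lo hi ∧ IsMaxOn (fun p => M.rev p x) (Set.Icc lo hi) (pstar x)

/-- Expected revenue `f_B(p) = E[f(p, x) | x ∈ B]` on a set `B` of contexts. -/
def DemandModel.avgRev (M : DemandModel X Y lo hi) (PX : Measure (Ctx d)) (B : Set (Ctx d))
    (p : ℝ) : ℝ := ∫ x, M.rev p x ∂(ProbabilityTheory.cond PX B)

/-- Assumption (A1): bounded domains, and contexts with a density on `X` bounded by `CX`. -/
def AssumptionA1 (X : Set (Ctx d)) (Y : Set ℝ) (lo hi : ℝ) (PX : Measure (Ctx d)) (CX : ℝ) :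
    Prop :=
  X ⊆ unitCube d ∧ Y ⊆ Set.Icc 0 1 ∧ Set.Icc lo hi ⊆ Set.Icc 0 1 ∧ IsProbabilityMeasure PX ∧
    ∃ χ : Ctx d → ENNReal, Measurable χ ∧ PX = (volume.restrict X).withDensity χ ∧
      ∀ x ∈ X, χ x ≤ ENNReal.ofReal CX

/-- Assumption (A2): the revenue function is Lipschitz. -/
def DemandModel.AssumptionA2 (M : DemandModel X Y lo hi) (CL : ℝ) : Prop :=
  ∀ p ∈ Set.Icc lo hi, ∀ p' ∈ Set.Icc lo hi, ∀ x ∈ X, ∀ x' ∈ X,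
    |M.rev p x - M.rev p' x'| ≤ CL * (|p - p'| + ‖x - x'‖)

/-- Assumption (A3), for the pointwise optimal prices `pstar`; `pB` is the optimal price on `B`. -/
def DemandModel.AssumptionA3 (M : DemandModel X Y lo hi) (PX : Measure (Ctx d))
    (pstar : Ctx d → ℝ) (σH CH Cp : ℝ) : Prop :=
  0 < σH ∧ σH ≤ CH ∧
  ∀ (a : Ctx d) (l : ℝ), 0 < l → hypercube a l ⊆ X → PX (hypercube a l) ≠ 0 →
    ∃ pB ∈ Set.Ioo lo hi,
      IsMaxOn (M.avgRev PX (hypercube a l)) (Set.Icc lo hi) pB ∧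
      ContDiffOn ℝ 2 (M.avgRev PX (hypercube a l)) (Set.Icc lo hi) ∧
      (∀ p ∈ Set.Ioo lo hi,
        σH ^ 2 ≤ -iteratedDeriv 2 (M.avgRev PX (hypercube a l)) p ∧
        -iteratedDeriv 2 (M.avgRev PX (hypercube a l)) p ≤ CH ^ 2) ∧
      sInf (pstar '' hypercube a l) ≤ pB ∧
      pB ≤ sSup (pstar '' hypercube a l) ∧
      sSup (pstar '' hypercube a l) - sInf (pstar '' hypercube a l) ≤
        Cp * Metric.diam (hypercube a l)

/-- The expected cumulative regret `E^π [∑_{t} f(p*(x_t), x_t) - f(p_t, x_t)]` of `π` over `T`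
periods. -/
def DemandModel.regret (M : DemandModel X Y lo hi) (PX : Measure (Ctx d)) (pstar : Ctx d → ℝ)
    {𝒵 : Type*} [MeasurableSpace 𝒵] (π : PricingPolicy X Y (Set.Icc lo hi) 𝒵) (T : ℕ) : ℝ :=
  ∫ ω, ∑ t : Fin T, (M.rev (pstar (ω t).1.1) (ω t).1.1 - M.rev (ω t).1.2.2 (ω t).1.1)
    ∂(π.law (PX.comap Subtype.val) M.D T)

end Model

end PrivatePricing

end

noncomputable section

namespace PrivatePricing

open scoped ENNReal

/-! ### Likelihood ratios -/

/-! On prices in `[1/2, 1]` take the revenue `3/8 - (p - 3/4)^2 + g x (p - 3/4)`, whose optimal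
price is `3/4 + g x / 2`. All these revenue curves meet at `p = 3/4`: that price reveals nothing
about `g`, and only departures from it are informative. The loss of a price is exactly the squared
distance to the optimum, so regret is the integral of `(p - 3/4 - g x / 2)^2` against the occupation
measure of context-price pairs. The unit cube is cut into `J^d` cells of side `h = 1/J`, and `g` is
a signed sum of disjoint cone-shaped bumps `φ k / 8`, one per cell. Write `S = ∫ φ k ^ 2`, of order
`h^(d+2)` up to a factor between `d^(-2)` and `1`. Flipping one sign changes the demand by at most
`φ k |p - 3/4| / 2`. Local privacy contracts this to a relative change of order `ε ∫ φ k |p - 3/4|`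
in the law of each recorded statistic (`statKer_ratio`). Summing squares over the periods
(`exists_likelihoodRatio`) and applying Cauchy–Schwarz bounds the divergence of the records by a
multiple of `ε² S` times the occupation integral of `(p - 3/4)^2` over the cell. That integral is at
most twice the regret on the cell plus `T S / 128`: learning a sign has to be paid for in regret. If
`ε² T S² ≤ 1`, the regrets on the cell under the two signs therefore add up to order `T S`
(`two_point_occupation`). Averaging over all sign vectors, as in Assouad's lemma
(`exists_le_integral_occupation`), gives regret of order `J^d T h^(d+2) / d^2 = T h^2 / d^2`. Taking
`J` of order `(ε² T)^(1/(2(d+2)))` yields the rate. -/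

theorem measurable_snoc {β : Type*} [MeasurableSpace β] (t : ℕ) :
    Measurable (fun q : (Fin t → β) × β => (Fin.snoc q.1 q.2 : Fin (t + 1) → β)) := by
  refine measurable_pi_lambda _ fun i => ?_
  refine Fin.lastCases ?_ (fun j => ?_) i
  · simpa using measurable_snd
  · simpa using! (measurable_pi_apply j).comp measurable_fst

/-- Two kernels whose values are comparable up to the factors `1 ± δ a` have a joint density
within `δ a` of `1`. -/
theorem exists_density_compProd {α β : Type*} [MeasurableSpace α] [MeasurableSpace β]
    (P : Measure α) [IsProbabilityMeasure P] (κ κ' : Kernel α β) [IsMarkovKernel κ]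
    [IsMarkovKernel κ'] (δ : α → ℝ) (hδ : Measurable δ) (hδ0 : ∀ a, 0 ≤ δ a)
    (h : ∀ a (U : Set β), MeasurableSet U → κ' a U ≤ ENNReal.ofReal (1 + δ a) * κ a U ∧
      ENNReal.ofReal (1 - δ a) * κ a U ≤ κ' a U) :
    ∃ r : α × β → ℝ, Measurable r ∧ (∀ q, 1 - δ q.1 ≤ r q ∧ r q ≤ 1 + δ q.1) ∧
      P ⊗ₘ κ' = (P ⊗ₘ κ).withDensity fun q => ENNReal.ofReal (r q) := by
  have hl : Measurable fun q : α × β => ENNReal.ofReal (1 - δ q.1) := by fun_prop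
  have key : ∀ k : α → ℝ≥0∞, Measurable k → ∀ V, MeasurableSet V →
      ∫⁻ q in V, k q.1 ∂(P ⊗ₘ κ) = ∫⁻ a, k a * κ a (Prod.mk a ⁻¹' V) ∂P := by
    intro k hk V hV
    rw [← lintegral_indicator hV, Measure.lintegral_compProd (by
      exact (hk.comp measurable_fst).indicator hV)]
    refine lintegral_congr fun a => ?_
    have : (fun b => V.indicator (fun q : α × β => k q.1) (a, b)) =
        (Prod.mk a ⁻¹' V).indicator fun _ => k a := rfl
    rw [this, lintegral_indicator (measurable_prodMk_left hV)]
    simp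
  have hac : P ⊗ₘ κ' ≪ P ⊗ₘ κ := by
    refine Measure.AbsolutelyContinuous.compProd_right (ae_of_all _ fun a => ?_)
    refine Measure.AbsolutelyContinuous.mk fun U hU h0 => ?_
    have := (h a U hU).1
    simpa [h0] using this
  -- Differentiating the joint laws, rather than `κ' a` for each `a`, makes the density jointly
  -- measurable over an arbitrary measurable space `β`.
  set ρ := (P ⊗ₘ κ').rnDeriv (P ⊗ₘ κ) with hρ
  have hρm : Measurable ρ := Measure.measurable_rnDeriv _ _
  have hρe : (P ⊗ₘ κ).withDensity ρ = P ⊗ₘ κ' := Measure.withDensity_rnDeriv_eq _ _ hac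
  have hρV : ∀ V, MeasurableSet V → ∫⁻ q in V, ρ q ∂(P ⊗ₘ κ) =
      ∫⁻ a, κ' a (Prod.mk a ⁻¹' V) ∂P := by
    intro V hV
    rw [← withDensity_apply _ hV, hρe, Measure.compProd_apply hV]
  have h1 : ρ ≤ᵐ[P ⊗ₘ κ] fun q => ENNReal.ofReal (1 + δ q.1) := by
    refine ae_le_of_forall_setLIntegral_le_of_sigmaFinite hρm fun V hV _ => ?_
    rw [hρV V hV, key (fun a => ENNReal.ofReal (1 + δ a)) (by fun_prop) V hV]
    exact lintegral_mono fun a => (h a _ (measurable_prodMk_left hV)).1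
  have h2 : (fun q => ENNReal.ofReal (1 - δ q.1)) ≤ᵐ[P ⊗ₘ κ] ρ := by
    refine ae_le_of_forall_setLIntegral_le_of_sigmaFinite hl fun V hV _ => ?_
    rw [hρV V hV, key (fun a => ENNReal.ofReal (1 - δ a)) (by fun_prop) V hV]
    exact lintegral_mono fun a => (h a _ (measurable_prodMk_left hV)).2
  -- Clamping changes the density only on a null set and makes the bounds hold at every point.
  refine ⟨fun q => max (1 - δ q.1) (min (ρ q).toReal (1 + δ q.1)), by fun_prop, fun q => ⟨le_max_left _ _,
    max_le (by linarith [hδ0 q.1]) (min_le_right _ _)⟩, ?_⟩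
  rw [← hρe]
  refine withDensity_congr_ae ?_
  filter_upwards [h1, h2] with q hq1 hq2
  have hfin : ρ q ≠ ∞ := ne_top_of_le_ne_top ENNReal.ofReal_ne_top hq1
  have h3 : (ρ q).toReal ≤ 1 + δ q.1 := by
    refine ENNReal.toReal_le_of_le_ofReal (by linarith [hδ0 q.1]) hq1
  have h4 : 1 - δ q.1 ≤ (ρ q).toReal := (ENNReal.ofReal_le_iff_le_toReal hfin).1 hq2
  rw [min_eq_left h3, max_eq_right h4, ENNReal.ofReal_toReal hfin]

/-- Follows from `-log r ≤ 1/r - 1 = (1 - r) + (1 - r)^2 / r` and `1/r ≤ 2`. The linear term is kept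
apart because it integrates to zero when `r` is a likelihood ratio, so that only the quadratic cost
remains. -/
theorem neg_log_le_of_abs_sub_one_le {r δ : ℝ} (h1 : 1 - δ ≤ r) (h2 : r ≤ 1 + δ)
    (hδ : δ ≤ 1 / 2) : -Real.log r ≤ (1 - r) + 2 * δ ^ 2 := by
  have hr : 0 < r := by linarith
  have h := Real.one_sub_inv_le_log_of_pos hr
  have h3 : r⁻¹ - 1 = (1 - r) + (1 - r) ^ 2 * r⁻¹ := by field_simp; ring
  have h4 : r⁻¹ ≤ 2 := by
    rw [inv_le_comm₀ hr (by norm_num)]; linarith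
  have h5 : (1 - r) ^ 2 ≤ δ ^ 2 := sq_le_sq' (by linarith) (by linarith)
  have h6 : (1 - r) ^ 2 * r⁻¹ ≤ δ ^ 2 * 2 := mul_le_mul h5 h4 (by positivity) (by positivity)
  linarith

/-- For `x ≤ 1`, the bound `log √x ≤ √x - 1` reduces the claim to `2 (√x - 1/2)^2 ≥ 0`. With `x` a
likelihood ratio, integration bounds the overlap of two laws below by `1/2` minus their
Kullback–Leibler divergence. -/
theorem half_sub_le_min_one {x : ℝ} (hx : 0 < x) :
    1 / 2 - (x - 1 - Real.log x) ≤ min 1 x := by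
  rcases le_total 1 x with h | h
  · rw [min_eq_left h]
    linarith [Real.log_le_sub_one_of_pos hx]
  · rw [min_eq_right h]
    have h1 := Real.log_le_sub_one_of_pos (show 0 < Real.sqrt x by positivity)
    have hs : Real.sqrt x ^ 2 = x := Real.sq_sqrt hx.le
    have hs1 : Real.sqrt x ≤ 1 := Real.sqrt_le_one.2 h
    have hs0 := Real.sqrt_nonneg x
    have h2 : Real.log x = 2 * Real.log (Real.sqrt x) := by
      rw [Real.log_sqrt hx.le]; ring
    nlinarith [sq_nonneg (Real.sqrt x - 1 / 2)]

/-- The two-point method: the mass of `min 1 L` bounds the sum of two expectations from below. -/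
theorem half_sub_le_add_integral {α : Type*} [MeasurableSpace α] (P P' : Measure α)
    [IsProbabilityMeasure P] [IsProbabilityMeasure P'] (L : α → ℝ) (hL : Measurable L)
    {a b : ℝ} (ha : 0 < a) (hab : ∀ w, a ≤ L w ∧ L w ≤ b)
    (hP : P' = P.withDensity fun w => ENNReal.ofReal (L w))
    (f g : α → ℝ) (hf : Measurable f) (hg : Measurable g) {C m : ℝ} (hm : 0 ≤ m)
    (hf0 : ∀ w, 0 ≤ f w ∧ f w ≤ C) (hg0 : ∀ w, 0 ≤ g w ∧ g w ≤ C)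
    (hfg : ∀ w, m ≤ f w + g w) :
    m * (1 / 2 - ∫ w, -Real.log (L w) ∂P) ≤ ∫ w, f w ∂P + ∫ w, g w ∂P' := by
  have hLpos : ∀ w, 0 < L w := fun w => ha.trans_le (hab w).1
  have hint : ∀ (h : α → ℝ), ∫ w, h w ∂P' = ∫ w, L w * h w ∂P := by
    intro h
    rw [hP, integral_withDensity_eq_integral_toReal_smul (by fun_prop) (by simp)]
    exact integral_congr_ae (ae_of_all _ fun w => by simp [(hLpos w).le])
  have bdd : ∀ (h : α → ℝ) (B : ℝ), Measurable h → (∀ w, |h w| ≤ B) → Integrable h P :=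
    fun h B hh hB => Integrable.of_bound hh.aestronglyMeasurable B (ae_of_all _ fun w => by
      simpa using hB w)
  have hLi : Integrable L P := bdd _ b hL fun w => by
    rw [abs_of_pos (hLpos w)]; exact (hab w).2
  have hlog : Integrable (fun w => Real.log (L w)) P := by
    refine bdd _ (max (-Real.log a) (Real.log b)) (by fun_prop) fun w => ?_
    rw [abs_le]
    constructor
    · have := Real.log_le_log ha (hab w).1
      linarith [le_max_left (-Real.log a) (Real.log b)]
    · exact (Real.log_le_log (hLpos w) (hab w).2).trans (le_max_right _ _)
  have h1 : ∫ w, L w ∂P = 1 := by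
    have := hint fun _ => 1
    simpa using this.symm
  have hLg : Integrable (fun w => L w * g w) P := by
    refine bdd _ (b * C) (by fun_prop) fun w => ?_
    rw [abs_of_nonneg (mul_nonneg (hLpos w).le (hg0 w).1)]
    exact mul_le_mul (hab w).2 (hg0 w).2 (hg0 w).1 ((hLpos w).le.trans (hab w).2)
  have hfi : Integrable f P := bdd _ C hf fun w => by
    rw [abs_of_nonneg (hf0 w).1]; exact (hf0 w).2
  rw [hint g, ← integral_add hfi hLg]
  have hL1 : Integrable (fun w => L w - 1) P := hLi.sub (integrable_const _)
  have hLl : Integrable (fun w => L w - 1 - Real.log (L w)) P := hL1.sub hlog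
  -- Since `L` has mean one, `L - 1 - log L` and `-log L` have the same mean.
  have h2 : m * (1 / 2 - ∫ w, -Real.log (L w) ∂P) =
      ∫ w, m * (1 / 2 - (L w - 1 - Real.log (L w))) ∂P := by
    rw [integral_const_mul, integral_sub (integrable_const _) hLl, integral_sub hL1 hlog,
      integral_sub hLi (integrable_const _), h1, integral_neg]
    simp
  rw [h2]
  refine integral_mono (((integrable_const _).sub hLl).const_mul m) (hfi.add hLg) fun w => ?_
  · have h3 := half_sub_le_min_one (hLpos w)
    have h4 : min 1 (L w) * (f w + g w) ≤ f w + L w * g w := by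
      nlinarith [min_le_left 1 (L w), min_le_right 1 (L w), (hf0 w).1, (hg0 w).1]
    have h5 : m * min 1 (L w) ≤ (f w + g w) * min 1 (L w) :=
      mul_le_mul_of_nonneg_right (hfg w) (le_min zero_le_one (hLpos w).le)
    have h6 := mul_le_mul_of_nonneg_left h3 hm
    dsimp only
    linarith

/-! ### Laws of prices and statistics under a policy -/

section Protocol

variable {𝒳 𝒴 𝓟 𝒵 : Type*} [MeasurableSpace 𝒳] [MeasurableSpace 𝒴]
  [MeasurableSpace 𝓟] [MeasurableSpace 𝒵]

/-- The law of `(x_t, p_t)` given `z_{<t}`. -/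
def PricingPolicy.choiceKer (π : PricingPolicy 𝒳 𝒴 𝓟 𝒵) (μ : Measure 𝒳) (t : ℕ) :
    Kernel (Fin t → 𝒵) (𝒳 × 𝓟) :=
  Kernel.const (Fin t → 𝒵) μ ⊗ₖ (π.A t).comap Prod.swap measurable_swap

/-- The law of `z_t` given `z_{<t}`. -/
def PricingPolicy.statKer (π : PricingPolicy 𝒳 𝒴 𝓟 𝒵) (μ : Measure 𝒳)
    (D : Kernel (𝒳 × 𝓟) 𝒴) (t : ℕ) : Kernel (Fin t → 𝒵) 𝒵 :=
  (π.roundLaw μ D t).snd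

/-- The law of `z_{<t}`. -/
def PricingPolicy.statLaw (π : PricingPolicy 𝒳 𝒴 𝓟 𝒵) (μ : Measure 𝒳)
    (D : Kernel (𝒳 × 𝓟) 𝒴) : (t : ℕ) → Measure (Fin t → 𝒵)
  | 0 => Measure.dirac Fin.elim0
  | t + 1 => (π.statLaw μ D t ⊗ₘ π.statKer μ D t).map
      fun q => (Fin.snoc q.1 q.2 : Fin (t + 1) → 𝒵)

variable (π : PricingPolicy 𝒳 𝒴 𝓟 𝒵) (μ : Measure 𝒳) [IsProbabilityMeasure μ]
  (D D' : Kernel (𝒳 × 𝓟) 𝒴) [IsMarkovKernel D] [IsMarkovKernel D']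

instance isMarkovKernel_choiceKer (t : ℕ) : IsMarkovKernel (π.choiceKer μ t) := by
  have := π.markovA t
  unfold PricingPolicy.choiceKer
  infer_instance

instance isMarkovKernel_dataLaw (t : ℕ) : IsMarkovKernel (π.dataLaw μ D t) := by
  have := π.markovA t
  unfold PricingPolicy.dataLaw
  exact Kernel.IsMarkovKernel.map _ (by fun_prop)

instance isMarkovKernel_roundLaw (t : ℕ) : IsMarkovKernel (π.roundLaw μ D t) := by
  have := π.markovQ t
  unfold PricingPolicy.roundLaw
  infer_instance

instance isMarkovKernel_statKer (t : ℕ) : IsMarkovKernel (π.statKer μ D t) := by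
  unfold PricingPolicy.statKer
  infer_instance

instance isProbabilityMeasure_statLaw (t : ℕ) : IsProbabilityMeasure (π.statLaw μ D t) := by
  induction t with
  | zero => exact Measure.dirac.isProbabilityMeasure
  | succ t ih => exact Measure.isProbabilityMeasure_map (measurable_snoc t).aemeasurable

instance isProbabilityMeasure_law (t : ℕ) : IsProbabilityMeasure (π.law μ D t) := by
  induction t with
  | zero => exact Measure.dirac.isProbabilityMeasure
  | succ t ih => exact Measure.isProbabilityMeasure_map (measurable_snoc t).aemeasurable

theorem statKer_apply (t : ℕ) (w : Fin t → 𝒵) {U : Set 𝒵} (hU : MeasurableSet U) :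
    π.statKer μ D t w U =
      ∫⁻ q, ∫⁻ y, π.Q t ((q.1, y, q.2), w) U ∂(D q) ∂(π.choiceKer μ t w) := by
  have := π.markovQ t
  have := π.markovA t
  have hm : Measurable fun s : 𝒳 × 𝒴 × 𝓟 => π.Q t (s, w) U :=
    ((π.Q t).measurable_coe hU).comp measurable_prodMk_right
  rw [PricingPolicy.statKer, Kernel.snd_apply' _ _ hU, PricingPolicy.roundLaw,
    Kernel.compProd_apply (measurable_snd hU)]
  change ∫⁻ s, π.Q t (s, w) U ∂(π.dataLaw μ D t w) = _
  have hm' : Measurable fun v : (𝒳 × 𝓟) × 𝒴 => π.Q t ((v.1.1, v.2, v.1.2), w) U :=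
    hm.comp (show Measurable fun v : (𝒳 × 𝓟) × 𝒴 => (v.1.1, v.2, v.1.2) by fun_prop)
  rw [PricingPolicy.dataLaw, Kernel.lintegral_map _ (by fun_prop) _ hm,
    Kernel.lintegral_compProd _ _ _ hm']
  rfl

theorem dataLaw_map (t : ℕ) (w : Fin t → 𝒵) :
    (π.dataLaw μ D t w).map (fun s => (s.1, s.2.2)) = π.choiceKer μ t w := by
  have := π.markovA t
  rw [PricingPolicy.dataLaw, Kernel.map_apply _ (by fun_prop), Measure.map_map (by fun_prop) (by fun_prop)]
  have h : (((Kernel.const (Fin t → 𝒵) μ ⊗ₖ (π.A t).comap Prod.swap measurable_swap) ⊗ₖ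
    Kernel.prodMkLeft (Fin t → 𝒵) D).fst) w = π.choiceKer μ t w := by
    rw [Kernel.fst_compProd]; rfl
  rw [← h, Kernel.fst_apply]
  rfl

/-- Given the past statistics, the pair `(x_t, p_t)` is drawn before the demand, so the right-hand
side is free of `D`: demand models influence regret only through the law of the statistics. -/
theorem integral_roundLaw (t : ℕ) (w : Fin t → 𝒵) {F : 𝒳 × 𝓟 → ℝ} (hF : Measurable F) :
    ∫ q, F (q.1.1, q.1.2.2) ∂(π.roundLaw μ D t w) = ∫ q, F q ∂(π.choiceKer μ t w) := by
  have := π.markovQ t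
  have h : (π.roundLaw μ D t).fst w = π.dataLaw μ D t w := by
    rw [PricingPolicy.roundLaw, Kernel.fst_compProd]
  rw [← dataLaw_map π μ D, ← h, Kernel.fst_apply, Measure.map_map (by fun_prop) (by fun_prop),
    integral_map (by fun_prop) hF.aestronglyMeasurable]
  rfl

/-- Each round depends on the past only through the recorded statistics, so these form a process of
their own. The information argument can then ignore contexts, prices and demands of past periods. -/
theorem law_map_stat (t : ℕ) :
    (π.law μ D t).map (fun ω i => (ω i).2) = π.statLaw μ D t := by
  induction t with
  | zero =>
    rw [PricingPolicy.law, PricingPolicy.statLaw, Measure.map_dirac' (by fun_prop)]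
    congr 1
    exact Subsingleton.elim _ _
  | succ t ih =>
    have hZ : Measurable fun (ω : Fin t → (𝒳 × 𝒴 × 𝓟) × 𝒵) (i : Fin t) => (ω i).2 := by fun_prop
    have hZ' : Measurable fun (ω : Fin (t + 1) → (𝒳 × 𝒴 × 𝓟) × 𝒵) (i : Fin (t + 1)) => (ω i).2 := by
      fun_prop
    rw [PricingPolicy.law, PricingPolicy.statLaw, Measure.map_map hZ' (measurable_snoc t), ← ih]
    have h : (π.law μ D t).map (fun ω i => (ω i).2) ⊗ₘ π.statKer μ D t =
        (π.law μ D t ⊗ₘ (π.roundLaw μ D t).comap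
          (fun (ω : Fin t → (𝒳 × 𝒴 × 𝓟) × 𝒵) (i : Fin t) => (ω i).2) (by fun_prop)).map
          (fun q => (fun i => (q.1 i).2, q.2.2)) := by
      have : IsProbabilityMeasure ((π.law μ D t).map (fun ω i => (ω i).2)) :=
        Measure.isProbabilityMeasure_map hZ.aemeasurable
      ext S hS
      rw [Measure.compProd_apply hS, Measure.map_apply (by fun_prop) hS,
        Measure.compProd_apply (by
          exact (show Measurable fun q : (Fin t → (𝒳 × 𝒴 × 𝓟) × 𝒵) × ((𝒳 × 𝒴 × 𝓟) × 𝒵) =>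
            ((fun i => (q.1 i).2 : Fin t → 𝒵), q.2.2) by fun_prop) hS),
        lintegral_map (Kernel.measurable_kernel_prodMk_left hS) hZ]
      refine lintegral_congr fun ω => ?_
      rw [PricingPolicy.statKer, Kernel.snd_apply' _ _ (measurable_prodMk_left hS)]
      rfl
    rw [h, Measure.map_map (measurable_snoc t) (by fun_prop)]
    congr 1
    funext q
    funext i
    refine Fin.lastCases ?_ (fun j => ?_) i <;> simp

/-- The expected cumulative cost of a policy, round by round. -/
theorem integral_law_sum {F : 𝒳 × 𝓟 → ℝ} (hF : Measurable F) {C : ℝ} (hC : ∀ q, |F q| ≤ C)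
    (T : ℕ) :
    ∫ ω, ∑ t : Fin T, F ((ω t).1.1, (ω t).1.2.2) ∂(π.law μ D T) =
      ∑ t ∈ Finset.range T, ∫ w, ∫ q, F q ∂(π.choiceKer μ t w) ∂(π.statLaw μ D t) := by
  induction T with
  | zero => simp
  | succ T ih =>
    rw [Finset.sum_range_succ, ← ih, PricingPolicy.law,
      integral_map (measurable_snoc T).aemeasurable
        (show Measurable fun ω : Fin (T + 1) → (𝒳 × 𝒴 × 𝓟) × 𝒵 =>
          ∑ t : Fin (T + 1), F ((ω t).1.1, (ω t).1.2.2) from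
          Finset.measurable_fun_sum _ fun t _ => hF.comp (by fun_prop)).aestronglyMeasurable]
    simp only [Fin.sum_univ_castSucc, Fin.snoc_castSucc, Fin.snoc_last]
    set K := (π.roundLaw μ D T).comap
      (fun (ω : Fin T → (𝒳 × 𝒴 × 𝓟) × 𝒵) (i : Fin T) => (ω i).2) (by fun_prop) with hK
    have h1 : Integrable (fun q : (Fin T → (𝒳 × 𝒴 × 𝓟) × 𝒵) × ((𝒳 × 𝒴 × 𝓟) × 𝒵) =>
        ∑ t : Fin T, F ((q.1 t).1.1, (q.1 t).1.2.2)) (π.law μ D T ⊗ₘ K) := by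
      refine Integrable.of_bound (Finset.measurable_fun_sum _ fun t _ =>
        hF.comp (by fun_prop)).aestronglyMeasurable (∑ t : Fin T, C) (ae_of_all _ fun q => ?_)
      exact (norm_sum_le _ _).trans (Finset.sum_le_sum fun t _ => hC _)
    have h2 : Integrable (fun q : (Fin T → (𝒳 × 𝒴 × 𝓟) × 𝒵) × ((𝒳 × 𝒴 × 𝓟) × 𝒵) =>
        F (q.2.1.1, q.2.1.2.2)) (π.law μ D T ⊗ₘ K) :=
      Integrable.of_bound (hF.comp (show Measurable fun q : (Fin T → (𝒳 × 𝒴 × 𝓟) × 𝒵) ×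
        ((𝒳 × 𝒴 × 𝓟) × 𝒵) => (q.2.1.1, q.2.1.2.2) by fun_prop)).aestronglyMeasurable C (ae_of_all _ fun q => hC _)
    rw [integral_add h1 h2, Measure.integral_compProd h1, Measure.integral_compProd h2]
    congr 1
    · simp
    · rw [← law_map_stat π μ D T, integral_map (Measurable.aemeasurable (by fun_prop))
        (hF.stronglyMeasurable.integral_kernel).aestronglyMeasurable]
      refine integral_congr_ae (ae_of_all _ fun ω => ?_)
      exact integral_roundLaw π μ D T _ hF

end Protocol

/-! ### Contraction by local privacy and the divergence of the records -/

theorem sq_integral_mul_le {α : Type*} [MeasurableSpace α] (P : Measure α) (f g : α → ℝ)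
    (hff : Integrable (fun x => f x ^ 2) P) (hfg : Integrable (fun x => f x * g x) P)
    (hgg : Integrable (fun x => g x ^ 2) P) :
    (∫ x, f x * g x ∂P) ^ 2 ≤ (∫ x, f x ^ 2 ∂P) * ∫ x, g x ^ 2 ∂P := by
  have h : ∀ s : ℝ, 0 ≤ (∫ x, f x ^ 2 ∂P) * (s * s) + (-2 * ∫ x, f x * g x ∂P) * s +
      ∫ x, g x ^ 2 ∂P := by
    intro s
    have h2 : Integrable (fun x => f x ^ 2 * (s * s) + -2 * (f x * g x) * s) P :=
      (hff.mul_const _).add ((hfg.const_mul _).mul_const _)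
    have h1 : (∫ x, f x ^ 2 ∂P) * (s * s) + (-2 * ∫ x, f x * g x ∂P) * s +
        ∫ x, g x ^ 2 ∂P = ∫ x, (f x * s - g x) ^ 2 ∂P := by
      rw [← integral_const_mul, ← integral_mul_const, ← integral_mul_const,
        ← integral_add (hff.mul_const _) ((hfg.const_mul _).mul_const _), ← integral_add h2 hgg]
      exact integral_congr_ae (ae_of_all _ fun x => by dsimp only; ring)
    rw [h1]
    exact integral_nonneg fun x => sq_nonneg _
  have := discrim_le_zero h
  rw [discrim] at this
  nlinarith

/-- For `ε ≤ 1` one has `exp ε - 1 ≤ 2 ε` and `exp ε ≤ 3`. In `statKer_ratio` the first factor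
compares two inputs of the recorder, the second compares one input with the average. -/
theorem exp_sub_one_mul_exp_le {ε : ℝ} (h0 : 0 < ε) (h1 : ε ≤ 1) :
    (Real.exp ε - 1) * Real.exp ε ≤ 6 * ε := by
  have h := Real.abs_exp_sub_one_sub_id_le (x := ε) (by rwa [abs_of_pos h0])
  have h2 := (abs_le.1 h).2
  have h3 : Real.exp ε - 1 ≤ 2 * ε := by nlinarith
  have h4 := Real.add_one_le_exp ε
  calc (Real.exp ε - 1) * Real.exp ε ≤ (2 * ε) * 3 :=
        mul_le_mul h3 (by linarith) (Real.exp_pos _).le (by linarith)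
    _ = 6 * ε := by ring

section Protocol

variable {𝒳 𝒴 𝓟 𝒵 : Type*} [MeasurableSpace 𝒳] [MeasurableSpace 𝒴]
  [MeasurableSpace 𝓟] [MeasurableSpace 𝒵]

/-- The kernel `D` draws `y₁` with probability `lam` and `y₀` otherwise. -/
structure IsTwoPoint (D : Kernel (𝒳 × 𝓟) 𝒴) (y₀ y₁ : 𝒴) (lam : 𝒳 × 𝓟 → ℝ) : Prop where
  measurable : Measurable lam
  mem : ∀ q, lam q ∈ Set.Icc (0 : ℝ) 1
  eq : ∀ q, D q = ENNReal.ofReal (lam q) • Measure.dirac y₁ +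
    ENNReal.ofReal (1 - lam q) • Measure.dirac y₀

variable (π : PricingPolicy 𝒳 𝒴 𝓟 𝒵) (μ : Measure 𝒳) [IsProbabilityMeasure μ]
  (D D' : Kernel (𝒳 × 𝓟) 𝒴) [IsMarkovKernel D] [IsMarkovKernel D']

/-- The law of a statistic is affine in the demand probability. Two models thus differ by the
integral of `lam' - lam` times the recorder's response to switching `y₀` and `y₁`. -/
theorem statKer_real {y₀ y₁ : 𝒴} {lam : 𝒳 × 𝓟 → ℝ} (hD : IsTwoPoint D y₀ y₁ lam) (t : ℕ)
    (w : Fin t → 𝒵) {U : Set 𝒵} (hU : MeasurableSet U) :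
    (π.statKer μ D t w).real U =
      ∫ q, (lam q * (π.Q t ((q.1, y₁, q.2), w)).real U +
        (1 - lam q) * (π.Q t ((q.1, y₀, q.2), w)).real U) ∂(π.choiceKer μ t w) := by
  have := π.markovQ t
  have hm : ∀ y, Measurable fun q : 𝒳 × 𝓟 => (π.Q t ((q.1, y, q.2), w)).real U := fun y =>
    (((π.Q t).measurable_coe hU).comp (show Measurable fun q : 𝒳 × 𝓟 => ((q.1, y, q.2), w) by
      fun_prop)).ennreal_toReal
  have hl := hD.measurable
  have hmm : Measurable fun q => lam q * (π.Q t ((q.1, y₁, q.2), w)).real U +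
        (1 - lam q) * (π.Q t ((q.1, y₀, q.2), w)).real U :=
    (hl.mul (hm _)).add ((measurable_const.sub hl).mul (hm _))
  rw [integral_eq_lintegral_of_nonneg_ae (ae_of_all _ fun q => add_nonneg
    (mul_nonneg (hD.mem q).1 measureReal_nonneg)
    (mul_nonneg (by linarith [(hD.mem q).2]) measureReal_nonneg))
    hmm.aestronglyMeasurable,
    measureReal_def, statKer_apply π μ D t w hU]
  congr 1
  refine lintegral_congr fun q => ?_
  have hy : Measurable fun y : 𝒴 => π.Q t ((q.1, y, q.2), w) U :=
    ((π.Q t).measurable_coe hU).comp (by fun_prop)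
  rw [hD.eq q, lintegral_add_measure, lintegral_smul_measure, lintegral_smul_measure,
    lintegral_dirac' _ hy, lintegral_dirac' _ hy,
    ENNReal.ofReal_add (mul_nonneg (hD.mem q).1 measureReal_nonneg)
      (mul_nonneg (by linarith [(hD.mem q).2]) measureReal_nonneg),
    ENNReal.ofReal_mul (hD.mem q).1, ENNReal.ofReal_mul (by linarith [(hD.mem q).2]),
    ofReal_measureReal, ofReal_measureReal, smul_eq_mul, smul_eq_mul]

/-- Local privacy contracts the difference of two demand models. -/
theorem statKer_ratio {T : ℕ} {ε : ℝ} (hε : 0 < ε) (hε1 : ε ≤ 1) (hπ : π.IsLDP T ε)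
    {y₀ y₁ : 𝒴} {lam lam' : 𝒳 × 𝓟 → ℝ} (hD : IsTwoPoint D y₀ y₁ lam)
    (hD' : IsTwoPoint D' y₀ y₁ lam') {η : 𝒳 × 𝓟 → ℝ} (hη : Measurable η)
    (hlam : ∀ q, |lam' q - lam q| ≤ η q) {C : ℝ} (hC : ∀ q, η q ≤ C) {t : ℕ} (ht : t < T)
    (w : Fin t → 𝒵) {U : Set 𝒵} (hU : MeasurableSet U) :
    π.statKer μ D' t w U ≤
        ENNReal.ofReal (1 + 6 * ε * ∫ q, η q ∂(π.choiceKer μ t w)) * π.statKer μ D t w U ∧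
      ENNReal.ofReal (1 - 6 * ε * ∫ q, η q ∂(π.choiceKer μ t w)) * π.statKer μ D t w U ≤
        π.statKer μ D' t w U := by
  have := π.markovQ t
  set ν := π.choiceKer μ t w with hν
  set a : 𝒳 × 𝒴 × 𝓟 → ℝ := fun s => (π.Q t (s, w)).real U with ha
  have ha0 : ∀ s, 0 ≤ a s := fun s => measureReal_nonneg
  have ha1 : ∀ s, a s ≤ 1 := fun s => measureReal_le_one
  have hm : ∀ y, Measurable fun q : 𝒳 × 𝓟 => a (q.1, y, q.2) := fun y =>
    (((π.Q t).measurable_coe hU).comp (show Measurable fun q : 𝒳 × 𝓟 => ((q.1, y, q.2), w) by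
      fun_prop)).ennreal_toReal
  have hldp : ∀ s s', a s ≤ Real.exp ε * a s' := by
    intro s s'
    have h := ENNReal.toReal_mono (ENNReal.mul_ne_top ENNReal.ofReal_ne_top (measure_ne_top _ _))
      (hπ t ht w s s' U hU)
    rwa [ENNReal.toReal_mul, ENNReal.toReal_ofReal (Real.exp_pos _).le] at h
  have hint : ∀ {l : 𝒳 × 𝓟 → ℝ}, Measurable l → (∀ q, l q ∈ Set.Icc (0 : ℝ) 1) →
      Integrable (fun q => l q * a (q.1, y₁, q.2) + (1 - l q) * a (q.1, y₀, q.2)) ν := by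
    intro l hl hl1
    refine Integrable.of_bound (((hl.mul (hm _)).add
      ((measurable_const.sub hl).mul (hm _))).aestronglyMeasurable) 1 (ae_of_all _ fun q => ?_)
    rw [Real.norm_eq_abs, abs_le]
    obtain ⟨h0, h1⟩ := hl1 q
    constructor <;> nlinarith [ha0 (q.1, y₁, q.2), ha1 (q.1, y₁, q.2), ha0 (q.1, y₀, q.2),
      ha1 (q.1, y₀, q.2), mul_nonneg h0 (ha0 (q.1, y₁, q.2)),
      mul_nonneg (sub_nonneg.2 h1) (ha0 (q.1, y₀, q.2))]
  have hk := statKer_real π μ D hD t w hU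
  have hk' := statKer_real π μ D' hD' t w hU
  set k := (π.statKer μ D t w).real U with hkdef
  set k' := (π.statKer μ D' t w).real U with hkdef'
  have hk0 : 0 ≤ k := measureReal_nonneg
  have hηi : Integrable η ν := Integrable.of_bound hη.aestronglyMeasurable C (ae_of_all _ fun q => by
    rw [Real.norm_eq_abs, abs_of_nonneg ((abs_nonneg _).trans (hlam q))]; exact hC q)
  have hIη : 0 ≤ ∫ q, η q ∂ν := integral_nonneg fun q => (abs_nonneg _).trans (hlam q)
  -- `k` is an average of values of `a`, each within a factor `exp ε` of `a s`.
  have hak : ∀ s, a s ≤ Real.exp ε * k := by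
    intro s
    have : ∫ _, a s ∂ν ≤ Real.exp ε * k := by
      rw [hk, ← integral_const_mul]
      refine integral_mono (integrable_const _) ((hint hD.measurable hD.mem).const_mul _) fun q => ?_
      obtain ⟨h0, h1⟩ := hD.mem q
      have e1 := mul_le_mul_of_nonneg_left (hldp s (q.1, y₁, q.2)) h0
      have e2 := mul_le_mul_of_nonneg_left (hldp s (q.1, y₀, q.2)) (sub_nonneg.2 h1)
      dsimp only at e1 e2 ⊢
      linarith
    simpa using this
  have hE : 0 ≤ Real.exp ε - 1 := by linarith [Real.add_one_le_exp ε]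
  -- The bound is relative to `k`, which is what turns the difference of the laws into a likelihood
  -- ratio bound.
  have hdiff : ∀ s s', |a s - a s'| ≤ 6 * ε * k := by
    have h : ∀ s s', a s - a s' ≤ 6 * ε * k := fun s s' =>
      calc a s - a s' ≤ (Real.exp ε - 1) * a s' := by linarith [hldp s s']
        _ ≤ (Real.exp ε - 1) * (Real.exp ε * k) := mul_le_mul_of_nonneg_left (hak s') hE
        _ = ((Real.exp ε - 1) * Real.exp ε) * k := by ring
        _ ≤ _ := mul_le_mul_of_nonneg_right (exp_sub_one_mul_exp_le hε hε1) hk0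
    intro s s'
    rw [abs_le]
    exact ⟨by linarith [h s' s], h s s'⟩
  have hmain : |k' - k| ≤ 6 * ε * (∫ q, η q ∂ν) * k := by
    rw [hk', hk, ← integral_sub (hint hD'.measurable hD'.mem) (hint hD.measurable hD.mem), ← hk]
    refine (abs_integral_le_integral_abs).trans ?_
    have e : 6 * ε * (∫ q, η q ∂ν) * k = ∫ q, 6 * ε * k * η q ∂ν := by
      rw [integral_const_mul]; ring
    rw [e]
    refine integral_mono_of_nonneg (ae_of_all _ fun q => abs_nonneg _) (hηi.const_mul _)
      (ae_of_all _ fun q => ?_)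
    have e2 : lam' q * a (q.1, y₁, q.2) + (1 - lam' q) * a (q.1, y₀, q.2) -
        (lam q * a (q.1, y₁, q.2) + (1 - lam q) * a (q.1, y₀, q.2)) =
        (a (q.1, y₁, q.2) - a (q.1, y₀, q.2)) * (lam' q - lam q) := by ring
    change |lam' q * a (q.1, y₁, q.2) + (1 - lam' q) * a (q.1, y₀, q.2) -
        (lam q * a (q.1, y₁, q.2) + (1 - lam q) * a (q.1, y₀, q.2))| ≤ _
    rw [e2, abs_mul]
    exact mul_le_mul (hdiff _ _) (hlam q) (abs_nonneg _) (by positivity)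
  have h2 := abs_le.1 hmain
  rw [← ofReal_measureReal (μ := π.statKer μ D' t w) (s := U),
    ← ofReal_measureReal (μ := π.statKer μ D t w) (s := U)]
  constructor
  · rw [← ENNReal.ofReal_mul (by positivity)]
    exact ENNReal.ofReal_le_ofReal (by linarith)
  · rw [← ENNReal.ofReal_mul' hk0]
    exact ENNReal.ofReal_le_ofReal (by linarith)

/-- The likelihood ratio of the recorded statistics under two demand models. -/
theorem exists_likelihoodRatio (δ : (t : ℕ) → (Fin t → 𝒵) → ℝ) (hδ : ∀ t, Measurable (δ t))
    (hδ0 : ∀ t w, 0 ≤ δ t w) (hδ1 : ∀ t w, δ t w ≤ 1 / 2) (T : ℕ)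
    (h : ∀ t < T, ∀ w (U : Set 𝒵), MeasurableSet U →
      π.statKer μ D' t w U ≤ ENNReal.ofReal (1 + δ t w) * π.statKer μ D t w U ∧
      ENNReal.ofReal (1 - δ t w) * π.statKer μ D t w U ≤ π.statKer μ D' t w U) :
    ∀ t ≤ T, ∃ L : (Fin t → 𝒵) → ℝ, Measurable L ∧
      (∃ a b : ℝ, 0 < a ∧ ∀ w, a ≤ L w ∧ L w ≤ b) ∧
      π.statLaw μ D' t = (π.statLaw μ D t).withDensity (fun w => ENNReal.ofReal (L w)) ∧
      ∫ w, -Real.log (L w) ∂(π.statLaw μ D t) ≤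
        ∑ s ∈ Finset.range t, 2 * ∫ w, δ s w ^ 2 ∂(π.statLaw μ D s) := by
  intro t
  induction t with
  | zero =>
    intro _
    exact ⟨fun _ => 1, measurable_const, ⟨1, 1, one_pos, by simp⟩, by simp [PricingPolicy.statLaw],
      by simp⟩
  | succ t ih =>
    intro ht
    obtain ⟨L, hL, ⟨a, b, ha, hab⟩, hLd, hLi⟩ := ih (by omega)
    obtain ⟨r, hr, hrb, hrd⟩ := exists_density_compProd (π.statLaw μ D t) (π.statKer μ D t)
      (π.statKer μ D' t) (δ t) (hδ t) (hδ0 t) (h t (by omega))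
    have hLpos : ∀ w, 0 < L w := fun w => ha.trans_le (hab w).1
    have hrl : ∀ q, 1 / 2 ≤ r q := fun q => by linarith [(hrb q).1, hδ1 t q.1]
    have hru : ∀ q, r q ≤ 2 := fun q => by linarith [(hrb q).2, hδ1 t q.1]
    have hrpos : ∀ q, 0 < r q := fun q => by linarith [hrl q]
    set P := π.statLaw μ D t
    set κ := π.statKer μ D t
    have hsplit : Measurable fun v : Fin (t + 1) → 𝒵 =>
        ((fun i => v i.castSucc : Fin t → 𝒵), v (Fin.last t)) := by fun_prop
    -- Chain rule: the ratio of the past times the conditional ratio `r` of the new statistic.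
    have hjoint : π.statLaw μ D' t ⊗ₘ π.statKer μ D' t =
        (P ⊗ₘ κ).withDensity fun q => ENNReal.ofReal (L q.1 * r q) := by
      have e : (fun q : (Fin t → 𝒵) × 𝒵 => ENNReal.ofReal (L q.1 * r q)) =
          (fun q => ENNReal.ofReal (r q)) * fun q => ENNReal.ofReal (L q.1) := by
        funext q
        rw [Pi.mul_apply, mul_comm (L q.1), ENNReal.ofReal_mul (hrpos q).le]
      rw [e, withDensity_mul _ (by fun_prop) (by fun_prop), ← hrd]
      ext V hV
      rw [Measure.compProd_apply hV, withDensity_apply _ hV, ← lintegral_indicator hV,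
        Measure.lintegral_compProd (Measurable.indicator (by fun_prop) hV), hLd,
        lintegral_withDensity_eq_lintegral_mul _ (by fun_prop)
          (Kernel.measurable_kernel_prodMk_left hV)]
      refine lintegral_congr fun w => ?_
      have e2 : (fun z => V.indicator (fun q : (Fin t → 𝒵) × 𝒵 => ENNReal.ofReal (L q.1)) (w, z)) =
          (Prod.mk w ⁻¹' V).indicator fun _ => ENNReal.ofReal (L w) := rfl
      rw [e2, lintegral_indicator (measurable_prodMk_left hV)]
      simp
    have hLm : Measurable fun v : Fin (t + 1) → 𝒵 =>
        L (fun i => v i.castSucc) * r (fun i => v i.castSucc, v (Fin.last t)) :=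
      (hL.comp (show Measurable fun (v : Fin (t + 1) → 𝒵) (i : Fin t) => v i.castSucc by
        fun_prop)).mul (hr.comp hsplit)
    refine ⟨fun v => L (fun i => v i.castSucc) * r (fun i => v i.castSucc, v (Fin.last t)),
      hLm, ⟨a * (1 / 2), b * 2, by positivity, fun v =>
        ⟨mul_le_mul (hab _).1 (hrl _) (by norm_num) (hLpos _).le,
          mul_le_mul (hab _).2 (hru _) (hrpos _).le ((hLpos (fun i => v i.castSucc)).le.trans
            (hab _).2)⟩⟩, ?_, ?_⟩
    · rw [PricingPolicy.statLaw, PricingPolicy.statLaw, hjoint]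
      ext V hV
      have hm : Measurable fun v : Fin (t + 1) → 𝒵 => ENNReal.ofReal
          (L (fun i => v i.castSucc) * r (fun i => v i.castSucc, v (Fin.last t))) :=
        hLm.ennreal_ofReal
      rw [Measure.map_apply (measurable_snoc t) hV, withDensity_apply _ (measurable_snoc t hV),
        withDensity_apply _ hV, setLIntegral_map hV hm (measurable_snoc t)]
      simp [P, κ]
    · rw [PricingPolicy.statLaw, integral_map (measurable_snoc t).aemeasurable
        (show Measurable fun v : Fin (t + 1) → 𝒵 => -Real.log (L (fun i => v i.castSucc) *
          r (fun i => v i.castSucc, v (Fin.last t))) from hLm.log.neg).aestronglyMeasurable]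
      simp only [Fin.snoc_castSucc, Fin.snoc_last]
      have bdd : ∀ (g : (Fin t → 𝒵) × 𝒵 → ℝ) (B : ℝ), Measurable g → (∀ q, |g q| ≤ B) →
          Integrable g (P ⊗ₘ κ) := fun g B hg hB =>
        Integrable.of_bound hg.aestronglyMeasurable B (ae_of_all _ fun q => hB q)
      have habs : ∀ x y z : ℝ, 0 < x → x ≤ y → y ≤ z →
          |(-Real.log y)| ≤ max (-Real.log x) (Real.log z) := by
        intro x y z hx hxy hyz
        rw [abs_neg, abs_le]
        constructor
        · linarith [le_max_left (-Real.log x) (Real.log z), Real.log_le_log hx hxy]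
        · exact (Real.log_le_log (hx.trans_le hxy) hyz).trans (le_max_right _ _)
      have i1 : Integrable (fun q : (Fin t → 𝒵) × 𝒵 => -Real.log (L q.1)) (P ⊗ₘ κ) :=
        bdd _ _ (by fun_prop) fun q => habs a _ b ha (hab q.1).1 (hab q.1).2
      have i2 : Integrable (fun q : (Fin t → 𝒵) × 𝒵 => -Real.log (r q)) (P ⊗ₘ κ) :=
        bdd _ _ (by fun_prop) fun q => habs (1 / 2) _ 2 (by norm_num) (hrl q) (hru q)
      have i3 : Integrable (fun q : (Fin t → 𝒵) × 𝒵 => r q) (P ⊗ₘ κ) :=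
        bdd _ 2 hr fun q => by rw [abs_of_pos (hrpos q)]; exact hru q
      have i4 : Integrable (fun q : (Fin t → 𝒵) × 𝒵 => δ t q.1 ^ 2) (P ⊗ₘ κ) := by
        have := hδ t
        refine bdd _ 1 (by fun_prop) fun q => ?_
        rw [abs_of_nonneg (sq_nonneg _)]
        nlinarith [hδ0 t q.1, hδ1 t q.1]
      have i5 : Integrable (fun q : (Fin t → 𝒵) × 𝒵 => 1 - r q) (P ⊗ₘ κ) :=
        (integrable_const _).sub i3
      have hr1 : ∫ q, r q ∂(P ⊗ₘ κ) = 1 := by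
        have e : (P ⊗ₘ π.statKer μ D' t) Set.univ = 1 := measure_univ
        rw [hrd, withDensity_apply _ MeasurableSet.univ, Measure.restrict_univ] at e
        rw [integral_eq_lintegral_of_nonneg_ae (ae_of_all _ fun q => (hrpos q).le)
          hr.aestronglyMeasurable, e]
        simp
      have e1 : ∫ q, -Real.log (L q.1) ∂(P ⊗ₘ κ) = ∫ w, -Real.log (L w) ∂P := by
        rw [Measure.integral_compProd i1]; simp
      have e2 : ∫ q, δ t q.1 ^ 2 ∂(P ⊗ₘ κ) = ∫ w, δ t w ^ 2 ∂P := by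
        rw [Measure.integral_compProd i4]; simp
      -- The linear term `1 - r` has mean zero by `hr1`, leaving a cost quadratic in `δ`.
      have e3 : ∫ q, -Real.log (r q) ∂(P ⊗ₘ κ) ≤ 2 * ∫ w, δ t w ^ 2 ∂P := by
        have : ∫ q, ((1 - r q) + 2 * δ t q.1 ^ 2) ∂(P ⊗ₘ κ) = 2 * ∫ w, δ t w ^ 2 ∂P := by
          rw [integral_add i5 (i4.const_mul 2),
            integral_sub (integrable_const _) i3, hr1, integral_const_mul, e2]
          simp
        rw [← this]
        exact integral_mono i2 (i5.add (i4.const_mul 2)) fun q =>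
          neg_log_le_of_abs_sub_one_le (hrb q).1 (hrb q).2 (hδ1 t q.1)
      rw [Finset.sum_range_succ]
      have e4 : ∫ q : (Fin t → 𝒵) × 𝒵, -Real.log (L q.1 * r (q.1, q.2)) ∂(P ⊗ₘ κ) =
          ∫ q, -Real.log (L q.1) ∂(P ⊗ₘ κ) + ∫ q, -Real.log (r q) ∂(P ⊗ₘ κ) := by
        rw [← integral_add i1 i2]
        refine integral_congr_ae (ae_of_all _ fun q => ?_)
        change -Real.log (L q.1 * r q) = _
        rw [Real.log_mul (hLpos _).ne' (hrpos q).ne']; ring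
      change ∫ q : (Fin t → 𝒵) × 𝒵, -Real.log (L q.1 * r (q.1, q.2)) ∂(P ⊗ₘ κ) ≤ _
      rw [e4, e1]
      exact add_le_add hLi e3

end Protocol

/-! ### Occupation measures, the two-point bound and Assouad's lemma -/

section Protocol

variable {𝒳 𝒴 𝓟 𝒵 : Type*} [MeasurableSpace 𝒳] [MeasurableSpace 𝒴]
  [MeasurableSpace 𝓟] [MeasurableSpace 𝒵]

/-- The expected number of visits to context-price pairs during the first `T` periods. -/
def PricingPolicy.occupation (π : PricingPolicy 𝒳 𝒴 𝓟 𝒵) (μ : Measure 𝒳)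
    (D : Kernel (𝒳 × 𝓟) 𝒴) (T : ℕ) : Measure (𝒳 × 𝓟) :=
  ∑ t ∈ Finset.range T, (π.statLaw μ D t ⊗ₘ π.choiceKer μ t).snd

variable (π : PricingPolicy 𝒳 𝒴 𝓟 𝒵) (μ : Measure 𝒳) [IsProbabilityMeasure μ]
  (D D' : Kernel (𝒳 × 𝓟) 𝒴) [IsMarkovKernel D] [IsMarkovKernel D']

instance isFiniteMeasure_occupation (T : ℕ) : IsFiniteMeasure (π.occupation μ D T) := by
  unfold PricingPolicy.occupation
  infer_instance

theorem integrable_of_abs_le {α : Type*} [MeasurableSpace α] (P : Measure α) [IsFiniteMeasure P]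
    {F : α → ℝ} (hF : Measurable F) {C : ℝ} (hC : ∀ q, |F q| ≤ C) : Integrable F P :=
  Integrable.of_bound hF.aestronglyMeasurable C (ae_of_all _ hC)

theorem integral_occupation {F : 𝒳 × 𝓟 → ℝ} (hF : Measurable F) {C : ℝ} (hC : ∀ q, |F q| ≤ C)
    (T : ℕ) : ∫ q, F q ∂(π.occupation μ D T) =
      ∑ t ∈ Finset.range T, ∫ w, ∫ q, F q ∂(π.choiceKer μ t w) ∂(π.statLaw μ D t) := by
  rw [PricingPolicy.occupation,
    integral_finsetSum_measure fun t _ => integrable_of_abs_le _ hF hC]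
  refine Finset.sum_congr rfl fun t _ => ?_
  rw [Measure.snd, integral_map measurable_snd.aemeasurable hF.aestronglyMeasurable,
    Measure.integral_compProd (integrable_of_abs_le _ (show Measurable fun
      x : (Fin t → 𝒵) × 𝒳 × 𝓟 => F x.2 from hF.comp measurable_snd) fun q => hC q.2)]

/-- No policy can influence the contexts; this makes `∫ φ^2` a constant in the Cauchy–Schwarz step
of `two_point_occupation`. -/
theorem integral_choiceKer_fst {φ : 𝒳 → ℝ} (hφ : Measurable φ) (t : ℕ) (w : Fin t → 𝒵) :
    ∫ q, φ q.1 ∂(π.choiceKer μ t w) = ∫ x, φ x ∂μ := by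
  have := π.markovA t
  have h : (π.choiceKer μ t).fst w = μ := by
    rw [PricingPolicy.choiceKer, Kernel.fst_compProd, Kernel.const_apply]
  conv_rhs => rw [← h, Kernel.fst_apply, integral_map measurable_fst.aemeasurable
    hφ.aestronglyMeasurable]

theorem integral_occupation_fst {φ : 𝒳 → ℝ} (hφ : Measurable φ) {C : ℝ} (hC : ∀ q, |φ q| ≤ C)
    (T : ℕ) : ∫ q, φ q.1 ∂(π.occupation μ D T) = T * ∫ x, φ x ∂μ := by
  rw [integral_occupation π μ D (show Measurable fun q : 𝒳 × 𝓟 => φ q.1 from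
    hφ.comp measurable_fst) (fun q => hC q.1)]
  simp [integral_choiceKer_fst π μ hφ]

/-- Two demand models that differ by at most `φ v / 2` cannot both be handled well by a private
policy that rarely visits the support of `v`. -/
theorem two_point_occupation {T : ℕ} {ε : ℝ} (hε : 0 < ε) (hε1 : ε ≤ 1) (hπ : π.IsLDP T ε)
    {y₀ y₁ : 𝒴} {lam lam' : 𝒳 × 𝓟 → ℝ} (hD : IsTwoPoint D y₀ y₁ lam)
    (hD' : IsTwoPoint D' y₀ y₁ lam') {φ : 𝒳 → ℝ} (hφ : Measurable φ)
    (hφb : ∀ x, 0 ≤ φ x ∧ φ x ≤ 1 / 2) {v : 𝒳 × 𝓟 → ℝ} (hv : Measurable v)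
    (hvb : ∀ q, 0 ≤ v q ∧ v q ≤ 1 / 4) (hlam : ∀ q, |lam' q - lam q| ≤ φ q.1 * v q / 2)
    {f g : 𝒳 × 𝓟 → ℝ} (hf : Measurable f) (hg : Measurable g) {C : ℝ}
    (hfb : ∀ q, 0 ≤ f q ∧ f q ≤ C) (hgb : ∀ q, 0 ≤ g q ∧ g q ≤ C)
    (hfg : ∀ q, φ q.1 ^ 2 / 128 ≤ f q + g q) :
    T * ((∫ x, φ x ^ 2 ∂μ) / 128 * (1 / 2 - 18 * ε ^ 2 * (∫ x, φ x ^ 2 ∂μ) *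
        ∫ q, v q ^ 2 ∂(π.occupation μ D T))) ≤
      ∫ q, f q ∂(π.occupation μ D T) + ∫ q, g q ∂(π.occupation μ D' T) := by
  set S := ∫ x, φ x ^ 2 ∂μ with hS
  have hS0 : 0 ≤ S := integral_nonneg fun x => sq_nonneg _
  have hφ2b : ∀ x, |φ x ^ 2| ≤ 1 := fun x => by
    rw [abs_of_nonneg (sq_nonneg _)]; nlinarith [(hφb x).1, (hφb x).2]
  have hv2b : ∀ q, |v q ^ 2| ≤ 1 := fun q => by
    rw [abs_of_nonneg (sq_nonneg _)]; nlinarith [(hvb q).1, (hvb q).2]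
  have hη0 : ∀ q, 0 ≤ φ q.1 * v q / 2 := fun q =>
    div_nonneg (mul_nonneg (hφb q.1).1 (hvb q).1) (by norm_num)
  have hη1 : ∀ q, φ q.1 * v q / 2 ≤ 1 / 16 := fun q => by
    have := mul_le_mul (hφb q.1).2 (hvb q).2 (hvb q).1 (by norm_num)
    linarith
  have hηm : Measurable fun q : 𝒳 × 𝓟 => φ q.1 * v q / 2 := by fun_prop
  set δ : (t : ℕ) → (Fin t → 𝒵) → ℝ :=
    fun t w => 6 * ε * ∫ q, φ q.1 * v q / 2 ∂(π.choiceKer μ t w) with hδ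
  have hδm : ∀ t, Measurable (δ t) := fun t =>
    (hηm.stronglyMeasurable.integral_kernel.measurable).const_mul _
  have hδ0 : ∀ t w, 0 ≤ δ t w := fun t w =>
    mul_nonneg (by positivity) (integral_nonneg hη0)
  have hδ1 : ∀ t w, δ t w ≤ 1 / 2 := fun t w => by
    have h : ∫ q, φ q.1 * v q / 2 ∂(π.choiceKer μ t w) ≤ ∫ _, (1 / 16 : ℝ) ∂(π.choiceKer μ t w) :=
      integral_mono (integrable_of_abs_le _ hηm fun q => by
        rw [abs_of_nonneg (hη0 q)]; exact hη1 q) (integrable_const _) hη1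
    have h0 : 0 ≤ ∫ q, φ q.1 * v q / 2 ∂(π.choiceKer μ t w) := integral_nonneg hη0
    simp only [integral_const, probReal_univ, one_smul] at h
    simp only [hδ]
    nlinarith
  -- Cauchy–Schwarz separates what is fixed by the context law, `S`, from what the policy controls,
  -- the integral of `v ^ 2`. The factor 9 is `(6 / 2)^2`.
  have hδ2 : ∀ t w, δ t w ^ 2 ≤ 9 * ε ^ 2 * S * ∫ q, v q ^ 2 ∂(π.choiceKer μ t w) := fun t w => by
    have h := sq_integral_mul_le (π.choiceKer μ t w) (fun q => φ q.1) v
      (integrable_of_abs_le _ (by fun_prop) fun q => hφ2b q.1)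
      (integrable_of_abs_le _ (by fun_prop) (C := 1) fun q => by
        rw [abs_of_nonneg (by linarith [hη0 q])]; linarith [hη1 q])
      (integrable_of_abs_le _ (by fun_prop) hv2b)
    have h2 := integral_choiceKer_fst π μ (φ := fun x => φ x ^ 2) (by fun_prop) t w
    rw [h2, ← hS] at h
    have e : δ t w = 3 * ε * ∫ q, φ q.1 * v q ∂(π.choiceKer μ t w) := by
      simp only [hδ]; rw [integral_div]; ring
    rw [e]
    calc (3 * ε * ∫ q, φ q.1 * v q ∂(π.choiceKer μ t w)) ^ 2 =
        9 * ε ^ 2 * (∫ q, φ q.1 * v q ∂(π.choiceKer μ t w)) ^ 2 := by ring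
      _ ≤ 9 * ε ^ 2 * (S * ∫ q, v q ^ 2 ∂(π.choiceKer μ t w)) :=
        mul_le_mul_of_nonneg_left h (by positivity)
      _ = _ := by ring
  have hv2m : Measurable fun q => v q ^ 2 := by fun_prop
  have hbdd : ∀ (F : 𝒳 × 𝓟 → ℝ) (B : ℝ), (∀ q, 0 ≤ F q ∧ F q ≤ B) → Measurable F → ∀ t w,
      0 ≤ ∫ q, F q ∂(π.choiceKer μ t w) ∧ ∫ q, F q ∂(π.choiceKer μ t w) ≤ B := by
    intro F B hB hF t w
    refine ⟨integral_nonneg fun q => (hB q).1, ?_⟩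
    have := integral_mono (μ := π.choiceKer μ t w) (integrable_of_abs_le _ hF fun q => by
        rw [abs_of_nonneg (hB q).1]; exact (hB q).2) (integrable_const B) fun q => (hB q).2
    simpa using this
  have hratio := exists_likelihoodRatio π μ D D' δ hδm hδ0 hδ1 T fun t ht w U hU =>
    statKer_ratio π μ D D' hε hε1 hπ hD hD' hηm hlam hη1 ht w hU
  have hV : ∑ s ∈ Finset.range T, 2 * ∫ w, δ s w ^ 2 ∂(π.statLaw μ D s) ≤
      18 * ε ^ 2 * S * ∫ q, v q ^ 2 ∂(π.occupation μ D T) := by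
    rw [integral_occupation π μ D hv2m hv2b, Finset.mul_sum]
    refine Finset.sum_le_sum fun t _ => ?_
    have : ∫ w, δ t w ^ 2 ∂(π.statLaw μ D t) ≤
        ∫ w, 9 * ε ^ 2 * S * ∫ q, v q ^ 2 ∂(π.choiceKer μ t w) ∂(π.statLaw μ D t) := by
      refine integral_mono (integrable_of_abs_le _ ((hδm t).pow_const 2) (C := 1) fun w => ?_)
        (Integrable.const_mul (integrable_of_abs_le _
          hv2m.stronglyMeasurable.integral_kernel.measurable (C := 1) fun w => ?_) _) (hδ2 t)
      · rw [abs_of_nonneg (sq_nonneg _)]; nlinarith [hδ0 t w, hδ1 t w]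
      · have := hbdd _ 1 (fun q => ⟨sq_nonneg (v q), (le_abs_self _).trans (hv2b q)⟩) hv2m t w
        rw [abs_of_nonneg this.1]; exact this.2
    rw [integral_const_mul] at this
    linarith
  have habs : ∀ {F : 𝒳 × 𝓟 → ℝ}, (∀ q, 0 ≤ F q ∧ F q ≤ C) → ∀ q, |F q| ≤ C := fun h q => by
    rw [abs_of_nonneg (h q).1]; exact (h q).2
  rw [integral_occupation π μ D hf (habs hfb), integral_occupation π μ D' hg (habs hgb),
    ← Finset.sum_add_distrib]
  calc _ = ∑ t ∈ Finset.range T, S / 128 * (1 / 2 - 18 * ε ^ 2 * S *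
        ∫ q, v q ^ 2 ∂(π.occupation μ D T)) := by
        rw [Finset.sum_const, Finset.card_range, nsmul_eq_mul]
    _ ≤ _ := Finset.sum_le_sum fun t ht => ?_
  have htT : t ≤ T := (Finset.mem_range.1 ht).le
  obtain ⟨L, hL, ⟨a, b, ha, hab⟩, hLd, hLi⟩ := hratio t htT
  have hm0 : 0 ≤ S / 128 := by positivity
  -- The two-point method is applied in every period to the statistics recorded so far; their
  -- divergence is at most the one accumulated over all `T` periods.
  have h := half_sub_le_add_integral (π.statLaw μ D t) (π.statLaw μ D' t) L hL ha hab hLd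
    (fun w => ∫ q, f q ∂(π.choiceKer μ t w)) (fun w => ∫ q, g q ∂(π.choiceKer μ t w))
    hf.stronglyMeasurable.integral_kernel.measurable
    hg.stronglyMeasurable.integral_kernel.measurable (C := C) hm0
    (fun w => hbdd f C hfb hf t w) (fun w => hbdd g C hgb hg t w) (fun w => ?_)
  · refine le_trans (mul_le_mul_of_nonneg_left ?_ hm0) h
    have hsub : ∑ s ∈ Finset.range t, 2 * ∫ w, δ s w ^ 2 ∂(π.statLaw μ D s) ≤
        ∑ s ∈ Finset.range T, 2 * ∫ w, δ s w ^ 2 ∂(π.statLaw μ D s) :=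
      Finset.sum_le_sum_of_subset_of_nonneg (Finset.range_mono htT) fun s _ _ =>
        mul_nonneg zero_le_two (integral_nonneg fun w => sq_nonneg _)
    linarith
  · have hfi := integrable_of_abs_le (π.choiceKer μ t w) hf (habs hfb)
    have hgi := integrable_of_abs_le (π.choiceKer μ t w) hg (habs hgb)
    have hφi : Integrable (fun q : 𝒳 × 𝓟 => φ q.1 ^ 2 / 128) (π.choiceKer μ t w) :=
      (integrable_of_abs_le _ (F := fun q : 𝒳 × 𝓟 => φ q.1 ^ 2) (by fun_prop)
        fun q => hφ2b q.1).div_const _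
    have e : S / 128 = ∫ q, φ q.1 ^ 2 / 128 ∂(π.choiceKer μ t w) := by
      rw [integral_div, integral_choiceKer_fst π μ (φ := fun x => φ x ^ 2) (by fun_prop) t w]
    rw [e, ← integral_add hfi hgi]
    exact integral_mono hφi (hfi.add hgi) hfg

/-- The sign attached to a bit. -/
def sgn (b : Bool) : ℝ := if b then 1 else -1

/-- Assouad's lemma for a family of demand models indexed by sign vectors. -/
theorem exists_le_integral_occupation {K : Type*} [Fintype K] [DecidableEq K]
    {T : ℕ} {ε : ℝ} (hε : 0 < ε) (hε1 : ε ≤ 1) (hπ : π.IsLDP T ε)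
    (D : (K → Bool) → Kernel (𝒳 × 𝓟) 𝒴) [∀ σ, IsMarkovKernel (D σ)] {y₀ y₁ : 𝒴}
    {lam : (K → Bool) → 𝒳 × 𝓟 → ℝ} (hD : ∀ σ, IsTwoPoint (D σ) y₀ y₁ (lam σ))
    {φ : K → 𝒳 → ℝ} (hφ : ∀ k, Measurable (φ k)) (hφb : ∀ k x, 0 ≤ φ k x ∧ φ k x ≤ 1 / 2)
    (hφd : ∀ x k k', k ≠ k' → φ k x = 0 ∨ φ k' x = 0)
    {u : 𝓟 → ℝ} (hu : Measurable u) (hub : ∀ p, |u p| ≤ 1 / 4)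
    (hlam : ∀ σ k q, |lam (Function.update σ k (!σ k)) q - lam σ q| ≤ φ k q.1 * |u q.2| / 2)
    {s : ℝ} (hs0 : 0 ≤ s) (hs : ∀ k, s ≤ ∫ x, φ k x ^ 2 ∂μ)
    (hinfo : ∀ k, ε ^ 2 * T * (∫ x, φ k x ^ 2 ∂μ) ^ 2 ≤ 1) :
    ∃ σ, (Fintype.card K) * (T * s) / 1000 ≤
      ∫ q, (u q.2 - ∑ k, sgn (σ k) * φ k q.1 / 16) ^ 2 ∂(π.occupation μ (D σ) T) := by
  classical
  set B : K → Set (𝒳 × 𝓟) := fun k => {q | φ k q.1 ≠ 0} with hB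
  have hBm : ∀ k, MeasurableSet (B k) := fun k =>
    (measurableSet_eq_fun ((hφ k).comp measurable_fst) measurable_const).compl
  -- `f b k` is the loss on cell `k` when its sign is `b`; below, `v k` measures how informative a
  -- price is about that sign.
  set f : Bool → K → 𝒳 × 𝓟 → ℝ :=
    fun b k => (B k).indicator fun q => (u q.2 - sgn b * φ k q.1 / 16) ^ 2 with hf
  set v : K → 𝒳 × 𝓟 → ℝ := fun k => (B k).indicator fun q => |u q.2| with hv
  have hfm : ∀ b k, Measurable (f b k) := fun b k =>
    Measurable.indicator (by have := hφ k; fun_prop) (hBm k)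
  have hvm : ∀ k, Measurable (v k) := fun k => Measurable.indicator (by fun_prop) (hBm k)
  have hsgn : ∀ b, sgn b = 1 ∨ sgn b = -1 := fun b => by cases b <;> simp [sgn]
  have hsgn' : ∀ b, sgn (!b) = -sgn b := fun b => by cases b <;> simp [sgn]
  have hfb : ∀ b k q, 0 ≤ f b k q ∧ f b k q ≤ 1 := by
    intro b k q
    by_cases hq : q ∈ B k
    · simp only [hf, Set.indicator_of_mem hq]
      refine ⟨sq_nonneg _, ?_⟩
      have h1 := abs_le.1 (hub q.2)
      have h2 := hφb k q.1
      rcases hsgn b with h | h <;> rw [h] <;> nlinarith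
    · simp [hf, Set.indicator_of_notMem hq]
  have hvb : ∀ k q, 0 ≤ v k q ∧ v k q ≤ 1 / 4 := by
    intro k q
    by_cases hq : q ∈ B k
    · simp only [hv, Set.indicator_of_mem hq]
      exact ⟨abs_nonneg _, hub _⟩
    · simp [hv, Set.indicator_of_notMem hq]
  have hfi : ∀ σ b k, Integrable (f b k) (π.occupation μ (D σ) T) := fun σ b k =>
    integrable_of_abs_le _ (hfm b k) (C := 1) fun q => by
      rw [abs_of_nonneg (hfb b k q).1]; exact (hfb b k q).2
  have hφ2m : ∀ k, Measurable fun x => φ k x ^ 2 := fun k => (hφ k).pow_const 2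
  have hφ2b : ∀ k x, |φ k x ^ 2| ≤ 1 := fun k x => by
    rw [abs_of_nonneg (sq_nonneg _)]; nlinarith [(hφb k x).1, (hφb k x).2]
  set R : (K → Bool) → K → ℝ := fun σ k => ∫ q, f (σ k) k q ∂(π.occupation μ (D σ) T) with hR
  -- `46 / 16384 = 1 / 256 - 18 / 128 ^ 2`. The extra `36 / 128` is the price of information,
  -- charged to `σ` only because the divergence is computed under `D σ`.
  have hpair : ∀ σ k, T * s * (46 / 16384) ≤
      (1 + 36 / 128) * R σ k + R (Function.update σ k (!σ k)) k := by
    intro σ k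
    set S := ∫ x, φ k x ^ 2 ∂μ with hS
    have hS0 : 0 ≤ S := integral_nonneg fun x => sq_nonneg _
    have h := two_point_occupation π μ (D σ) (D (Function.update σ k (!σ k))) hε hε1 hπ (hD σ)
      (hD _) (hφ k) (hφb k) (hvm k) (hvb k) (fun q => ?_) (hfm (σ k) k) (hfm (!σ k) k)
      (hfb (σ k) k) (hfb (!σ k) k) fun q => ?_
    rotate_left
    · refine (hlam σ k q).trans (le_of_eq ?_)
      by_cases hq : q ∈ B k
      · simp only [hv, Set.indicator_of_mem hq]
      · have h0 : φ k q.1 = 0 := by simpa [hB] using hq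
        simp [h0]
    · by_cases hq : q ∈ B k
      · simp only [hf, Set.indicator_of_mem hq, hsgn']
        rcases hsgn (σ k) with h | h <;> rw [h] <;> nlinarith [sq_nonneg (u q.2)]
      · have h0 : φ k q.1 = 0 := by simpa [hB] using hq
        rw [h0]
        linarith [(hfb (σ k) k q).1, (hfb (!σ k) k q).1]
    -- Information costs regret: on the cell, `u² ≤ 2 (u ∓ φ/16)² + 2 (φ/16)²`.
    have hVle : ∫ q, v k q ^ 2 ∂(π.occupation μ (D σ) T) ≤ 2 * R σ k + T * S / 128 := by
      have hi : Integrable (fun q : 𝒳 × 𝓟 => φ k q.1 ^ 2 / 128) (π.occupation μ (D σ) T) :=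
        Integrable.div_const (integrable_of_abs_le _ ((hφ2m k).comp measurable_fst)
          fun q => hφ2b k q.1) _
      have e : 2 * R σ k + T * S / 128 =
          ∫ q, (2 * f (σ k) k q + φ k q.1 ^ 2 / 128) ∂(π.occupation μ (D σ) T) := by
        rw [integral_add ((hfi σ _ k).const_mul 2) hi, integral_const_mul, integral_div,
          integral_occupation_fst π μ (D σ) (hφ2m k) (hφ2b k)]
      rw [e]
      refine integral_mono (integrable_of_abs_le _ ((hvm k).pow_const 2) (C := 1) fun q => ?_)
        (((hfi σ _ k).const_mul 2).add hi) fun q => ?_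
      · rw [abs_of_nonneg (sq_nonneg _)]; nlinarith [(hvb k q).1, (hvb k q).2]
      · by_cases hq : q ∈ B k
        · simp only [hf, hv, Set.indicator_of_mem hq, sq_abs]
          rcases hsgn (σ k) with h | h <;> rw [h] <;>
            nlinarith [sq_nonneg (u q.2 - φ k q.1 / 8), sq_nonneg (u q.2 + φ k q.1 / 8)]
        · simp only [hf, hv, Set.indicator_of_notMem hq]
          linarith [sq_nonneg (φ k q.1)]
    have hR0 : 0 ≤ R σ k := integral_nonneg fun q => (hfb _ k q).1
    have hup : R (Function.update σ k (!σ k)) k =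
        ∫ q, f (!σ k) k q ∂(π.occupation μ (D (Function.update σ k (!σ k))) T) := by
      simp [hR]
    rw [hup]
    have hq := hinfo k
    rw [← hS] at hq
    have hT0 : (0 : ℝ) ≤ T := Nat.cast_nonneg T
    have h3 : T * (S / 128 * (1 / 2 - 18 * ε ^ 2 * S * (2 * R σ k + T * S / 128))) ≤
        T * (S / 128 * (1 / 2 - 18 * ε ^ 2 * S *
          ∫ q, v k q ^ 2 ∂(π.occupation μ (D σ) T))) := by
      gcongr
    have h4 : T * (S / 128 * (1 / 2 - 18 * ε ^ 2 * S * (2 * R σ k + T * S / 128))) =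
        T * S / 256 - (18 / 128) * (ε ^ 2 * T * S ^ 2) * (2 * R σ k + T * S / 128) := by ring
    have h5 : (ε ^ 2 * T * S ^ 2) * (2 * R σ k + T * S / 128) ≤ 1 * (2 * R σ k + T * S / 128) :=
      mul_le_mul_of_nonneg_right hq (by positivity)
    have h6 : T * s ≤ T * S := mul_le_mul_of_nonneg_left (hs k) hT0
    have hRd : R σ k = ∫ q, f (σ k) k q ∂(π.occupation μ (D σ) T) := rfl
    rw [← hRd, ← hS] at h
    linarith
  -- Flipping one coordinate permutes the sign vectors, so both terms of `hpair` have the same sum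
  -- over `σ`.
  have hflip : ∀ k, ∑ σ, R (Function.update σ k (!σ k)) k = ∑ σ, R σ k := by
    intro k
    have hinv : Function.Involutive fun σ : K → Bool => Function.update σ k (!σ k) := by
      intro σ; simp
    exact Equiv.sum_comp (hinv.toPerm _) fun σ => R σ k
  have hsum : ∀ k, ∑ _σ : K → Bool, T * s / 1000 ≤ ∑ σ, R σ k := by
    intro k
    have h := Finset.sum_le_sum fun σ (_ : σ ∈ (Finset.univ : Finset (K → Bool))) => hpair σ k
    rw [Finset.sum_add_distrib, hflip, Finset.sum_const, nsmul_eq_mul,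
      ← Finset.mul_sum _ _ (1 + 36 / 128 : ℝ)] at h
    rw [Finset.sum_const, nsmul_eq_mul]
    have hc : (0 : ℝ) ≤ ((Finset.univ : Finset (K → Bool)).card : ℝ) * (T * s) := by positivity
    linarith
  -- The cells are disjoint, so the losses counted cell by cell do not exceed the total loss.
  have hle : ∀ σ, ∑ k, R σ k ≤
      ∫ q, (u q.2 - ∑ k, sgn (σ k) * φ k q.1 / 16) ^ 2 ∂(π.occupation μ (D σ) T) := by
    intro σ
    have hone : ∀ q : 𝒳 × 𝓟, ∀ k, q ∈ B k →
        ∑ k, sgn (σ k) * φ k q.1 / 16 = sgn (σ k) * φ k q.1 / 16 := by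
      intro q k hk
      refine Finset.sum_eq_single k (fun k' _ hne => ?_) (by simp)
      rcases hφd q.1 k' k hne with h | h
      · simp [h]
      · exact absurd h hk
    have hpt : ∀ q, ∑ k, f (σ k) k q ≤ (u q.2 - ∑ k, sgn (σ k) * φ k q.1 / 16) ^ 2 := by
      intro q
      by_cases hq : ∃ k, q ∈ B k
      · obtain ⟨k, hk⟩ := hq
        rw [hone q k hk, Finset.sum_eq_single k (fun k' _ hne => ?_) (by simp)]
        · simp only [hf, Set.indicator_of_mem hk]; exact le_rfl
        · have : q ∉ B k' := fun h => by
            rcases hφd q.1 k' k hne with h' | h'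
            · exact h h'
            · exact hk h'
          simp [hf, Set.indicator_of_notMem this]
      · push Not at hq
        rw [Finset.sum_eq_zero fun k _ => by simp [hf, Set.indicator_of_notMem (hq k)]]
        positivity
    have hsb : ∀ q : 𝒳 × 𝓟, |∑ k, sgn (σ k) * φ k q.1 / 16| ≤ 1 := by
      intro q
      by_cases hq : ∃ k, q ∈ B k
      · obtain ⟨k, hk⟩ := hq
        rw [hone q k hk, abs_le]
        have := hφb k q.1
        rcases hsgn (σ k) with h | h <;> rw [h] <;> constructor <;> linarith
      · push Not at hq
        rw [Finset.sum_eq_zero fun k _ => by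
          have : φ k q.1 = 0 := by simpa [hB] using hq k
          simp [this]]
        simp
    simp only [hR]
    rw [← integral_finsetSum _ fun k _ => hfi σ _ k]
    refine integral_mono (integrable_finsetSum _ fun k _ => hfi σ _ k)
      (integrable_of_abs_le _ ?_ (C := 4) fun q => ?_) hpt
    · have : Measurable fun q : 𝒳 × 𝓟 => ∑ k, sgn (σ k) * φ k q.1 / 16 :=
        Finset.measurable_fun_sum _ fun k _ => by have := hφ k; fun_prop
      fun_prop
    · rw [abs_of_nonneg (sq_nonneg _)]
      have h1 := abs_le.1 (hub q.2)
      have h2 := abs_le.1 (hsb q)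
      nlinarith
  obtain ⟨σ, -, hσ⟩ : ∃ σ ∈ (Finset.univ : Finset (K → Bool)),
      (Fintype.card K) * (T * s) / 1000 ≤ ∑ k, R σ k := by
    refine Finset.exists_le_of_sum_le Finset.univ_nonempty ?_
    rw [Finset.sum_comm]
    calc ∑ _σ : K → Bool, (Fintype.card K) * (T * s) / 1000
        = ∑ _k : K, ∑ _σ : K → Bool, T * s / 1000 := by
          simp only [Finset.sum_const, nsmul_eq_mul, Finset.card_univ]; ring
      _ ≤ _ := Finset.sum_le_sum fun k _ => hsum k
  exact ⟨σ, hσ.trans (hle σ)⟩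

end Protocol

/-! ### Bump functions on the unit cube -/

section Geometry

variable {d : ℕ}

theorem pi_norm_ofLp_le (x : Ctx d) : ‖x.ofLp‖ ≤ ‖x‖ :=
  (pi_norm_le_iff_of_nonneg (norm_nonneg x)).2 fun i => PiLp.norm_apply_le x i

theorem measurableSet_unitCube : MeasurableSet (unitCube d) := by
  have : unitCube d = ⋂ i, (fun x : Ctx d => x i) ⁻¹' Set.Icc 0 1 := by
    ext x; simp [unitCube]
  rw [this]
  exact MeasurableSet.iInter fun i => measurableSet_Icc.preimage (by fun_prop)

theorem volume_unitCube : volume (unitCube d) = 1 := by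
  have h := (PiLp.volume_preserving_ofLp (Fin d)).measure_preimage
    (s := Set.Icc (fun _ => (0 : ℝ)) (fun _ => 1)) measurableSet_Icc.nullMeasurableSet
  have e : unitCube d = WithLp.ofLp ⁻¹' Set.Icc (fun _ : Fin d => (0 : ℝ)) (fun _ => 1) := by
    ext x; simp [unitCube, Pi.le_def, forall_and]
  rw [e, h, Real.volume_Icc_pi]
  simp

theorem isProbabilityMeasure_uniformCube : IsProbabilityMeasure (uniformCube d) :=
  ⟨by rw [uniformCube, Measure.restrict_apply_univ, volume_unitCube]⟩

theorem isBounded_unitCube : Bornology.IsBounded (unitCube d) := by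
  refine (Metric.isBounded_closedBall (x := (0 : Ctx d)) (r := √d)).subset fun x hx => ?_
  rw [mem_closedBall_zero_iff, EuclideanSpace.norm_eq]
  refine Real.sqrt_le_sqrt ?_
  calc ∑ i, ‖x i‖ ^ 2 ≤ ∑ _i : Fin d, (1 : ℝ) := Finset.sum_le_sum fun i _ => by
        rw [Real.norm_eq_abs, sq_abs]; nlinarith [(hx i).1, (hx i).2]
    _ = d := by simp

/-- The open sup-norm ball as a subset of Euclidean space. -/
def supBall (c : Fin d → ℝ) (r : ℝ) : Set (Ctx d) := WithLp.ofLp ⁻¹' Metric.ball c r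

theorem measurableSet_supBall (c : Fin d → ℝ) (r : ℝ) : MeasurableSet (supBall c r) :=
  Metric.isOpen_ball.measurableSet.preimage (by fun_prop)

theorem volume_supBall (c : Fin d → ℝ) {r : ℝ} (hr : 0 < r) :
    volume (supBall c r) = ENNReal.ofReal ((2 * r) ^ d) := by
  rw [supBall, (PiLp.volume_preserving_ofLp (Fin d)).measure_preimage
    Metric.isOpen_ball.measurableSet.nullMeasurableSet, Real.volume_pi_ball c hr, Fintype.card_fin]

/-- The cone of height `h / 2` over the sup-norm ball of radius `h / 2` around `c`. -/
def bump (h : ℝ) (c : Fin d → ℝ) (x : Ctx d) : ℝ := max 0 (h / 2 - ‖x.ofLp - c‖)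

theorem measurable_bump (h : ℝ) (c : Fin d → ℝ) : Measurable (bump h c) := by
  unfold bump; fun_prop

theorem bump_nonneg (h : ℝ) (c : Fin d → ℝ) (x : Ctx d) : 0 ≤ bump h c x := le_max_left _ _

theorem bump_le {h : ℝ} (hh : 0 ≤ h) (c : Fin d → ℝ) (x : Ctx d) : bump h c x ≤ h / 2 :=
  max_le (by linarith) (by linarith [norm_nonneg (x.ofLp - c)])

theorem bump_eq_zero {h : ℝ} {c : Fin d → ℝ} {x : Ctx d} (hx : x ∉ supBall c (h / 2)) :
    bump h c x = 0 := by
  rw [supBall, Set.mem_preimage, mem_ball_iff_norm, not_lt] at hx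
  exact max_eq_left (by linarith)

/-- The cone has slope one in the sup norm, which the Euclidean norm dominates. -/
theorem abs_bump_sub_le (h : ℝ) (c : Fin d → ℝ) (x y : Ctx d) :
    |bump h c x - bump h c y| ≤ ‖x - y‖ := by
  have h1 := abs_max_sub_max_le_abs (h / 2 - ‖x.ofLp - c‖) (h / 2 - ‖y.ofLp - c‖) 0
  rw [max_comm _ 0, max_comm _ 0] at h1
  refine h1.trans ?_
  have h2 : h / 2 - ‖x.ofLp - c‖ - (h / 2 - ‖y.ofLp - c‖) = ‖y.ofLp - c‖ - ‖x.ofLp - c‖ := by ring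
  rw [h2]
  refine (abs_norm_sub_norm_le _ _).trans ?_
  have h3 : y.ofLp - c - (x.ofLp - c) = -(x - y).ofLp := by simp
  rw [h3, norm_neg]
  exact pi_norm_ofLp_le _

theorem integral_bump_sq_le {h : ℝ} (hh : 0 < h) (c : Fin d → ℝ) :
    ∫ x, bump h c x ^ 2 ∂(uniformCube d) ≤ h ^ (d + 2) / 4 := by
  have := isProbabilityMeasure_uniformCube (d := d)
  have hle : ∀ x, bump h c x ^ 2 ≤ (supBall c (h / 2)).indicator (fun _ => h ^ 2 / 4) x := by
    intro x
    by_cases hx : x ∈ supBall c (h / 2)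
    · rw [Set.indicator_of_mem hx]
      nlinarith [bump_nonneg h c x, bump_le hh.le c x]
    · rw [Set.indicator_of_notMem hx, bump_eq_zero hx]; simp
  have h1 := integral_mono_of_nonneg (μ := uniformCube d) (ae_of_all _ fun x => sq_nonneg _)
    ((integrable_const (h ^ 2 / 4)).indicator (measurableSet_supBall c (h / 2))) (ae_of_all _ hle)
  rw [integral_indicator_const _ (measurableSet_supBall c (h / 2)), smul_eq_mul] at h1
  have h2 : (uniformCube d).real (supBall c (h / 2)) ≤ h ^ d := by
    refine ENNReal.toReal_le_of_le_ofReal (by positivity) ?_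
    refine (Measure.restrict_apply_le _ _).trans ?_
    rw [volume_supBall c (by positivity)]
    exact le_of_eq (by congr 2; ring)
  refine h1.trans ?_
  calc _ ≤ h ^ d * (h ^ 2 / 4) := mul_le_mul_of_nonneg_right h2 (by positivity)
    _ = _ := by ring

theorem le_integral_bump_sq (hd : 1 ≤ d) {h : ℝ} (hh : 0 < h) {c : Fin d → ℝ}
    (hc : supBall c (h / 2) ⊆ unitCube d) :
    h ^ (d + 2) / (32 * d ^ 2) ≤ ∫ x, bump h c x ^ 2 ∂(uniformCube d) := by
  have := isProbabilityMeasure_uniformCube (d := d)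
  have hd' : (1 : ℝ) ≤ d := by exact_mod_cast hd
  -- On this shrunken ball the bump is at least `h / (4 d)`, and by Bernoulli's inequality the ball
  -- keeps at least half the volume of the cell. This is where the factor `d ^ 2` arises.
  set r := h / 2 - h / (4 * d) with hr
  have hr2 : 2 * r = h * (1 - 1 / (2 * d)) := by rw [hr]; field_simp; ring
  have hd2 : 1 / (2 * (d : ℝ)) ≤ 1 / 2 := by
    rw [div_le_div_iff₀ (by positivity) (by norm_num)]; linarith
  have hr0 : 0 < r := by nlinarith
  have hrh : r ≤ h / 2 := by rw [hr]; linarith [show 0 ≤ h / (4 * d) by positivity]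
  have hsub : supBall c r ⊆ unitCube d := fun x hx =>
    hc (Metric.ball_subset_ball hrh hx)
  have hle : ∀ x, (supBall c r).indicator (fun _ => (h / (4 * d)) ^ 2) x ≤ bump h c x ^ 2 := by
    intro x
    by_cases hx : x ∈ supBall c r
    · rw [Set.indicator_of_mem hx]
      rw [supBall, Set.mem_preimage, mem_ball_iff_norm] at hx
      refine pow_le_pow_left₀ (by positivity) ?_ 2
      exact le_trans (by rw [hr] at hx; linarith) (le_max_right _ _)
    · rw [Set.indicator_of_notMem hx]; positivity
  have h1 := integral_mono_of_nonneg (μ := uniformCube d)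
    (ae_of_all _ fun x => Set.indicator_nonneg (fun _ _ => by positivity) x)
    (integrable_of_abs_le _ ((measurable_bump h c).pow_const 2) (C := h ^ 2) fun x => by
      rw [abs_of_nonneg (sq_nonneg _)]
      nlinarith [bump_nonneg h c x, bump_le hh.le c x]) (ae_of_all _ hle)
  rw [integral_indicator_const _ (measurableSet_supBall c r), smul_eq_mul] at h1
  have h2 : (uniformCube d).real (supBall c r) = (2 * r) ^ d := by
    rw [measureReal_def, uniformCube, Measure.restrict_apply (measurableSet_supBall c r),
      Set.inter_eq_left.2 hsub, volume_supBall c hr0, ENNReal.toReal_ofReal (by positivity)]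
  have h3 : (1 : ℝ) / 2 ≤ (1 - 1 / (2 * d)) ^ d := by
    have := one_add_mul_le_pow (a := -(1 / (2 * (d : ℝ)))) (by linarith) d
    have e : 1 + (d : ℝ) * -(1 / (2 * d)) = 1 / 2 := by field_simp; ring
    rw [e] at this
    simpa [sub_eq_add_neg] using this
  refine le_trans ?_ h1
  rw [h2, hr2, mul_pow]
  calc h ^ (d + 2) / (32 * d ^ 2) = h ^ d * (1 / 2) * (h / (4 * d)) ^ 2 := by
        field_simp; ring
    _ ≤ _ := by gcongr

/-- The centre of the cell with index `k` in the grid of mesh `1 / J`. -/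
def cellCenter (J : ℕ) (k : Fin d → Fin J) (i : Fin d) : ℝ := ((k i : ℝ) + 1 / 2) / J

theorem supBall_cellCenter_subset {J : ℕ} (hJ : 0 < J) (k : Fin d → Fin J) :
    supBall (cellCenter J k) (1 / (J : ℝ) / 2) ⊆ unitCube d := by
  intro x hx i
  have hJ' : (0 : ℝ) < J := by exact_mod_cast hJ
  rw [supBall, Set.mem_preimage, mem_ball_iff_norm] at hx
  have h1 := abs_lt.1 ((norm_le_pi_norm (x.ofLp - cellCenter J k) i).trans_lt hx)
  have h2 : ((k i : ℕ) : ℝ) + 1 ≤ J := by exact_mod_cast (k i).2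
  have h3 : (0 : ℝ) ≤ ((k i : ℕ) : ℝ) := Nat.cast_nonneg _
  simp only [Pi.sub_apply, cellCenter] at h1
  have e1 : (((k i : ℕ) : ℝ) + 1 / 2) / J - 1 / J / 2 = (k i : ℕ) / J := by field_simp; ring
  have e2 : (((k i : ℕ) : ℝ) + 1 / 2) / J + 1 / J / 2 = ((k i : ℕ) + 1) / J := by field_simp; ring
  have e3 : (0 : ℝ) ≤ (k i : ℕ) / J := by positivity
  have e4 : (((k i : ℕ) : ℝ) + 1) / J ≤ 1 := (div_le_one hJ').2 h2
  constructor <;> linarith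

/-- Distinct centres differ by at least `1 / J` in some coordinate, and the supports lie in cells of
half-width `1 / (2 J)`. -/
theorem bump_disjoint {J : ℕ} (hJ : 0 < J) {k k' : Fin d → Fin J} (hk : k ≠ k') (x : Ctx d) :
    bump (1 / (J : ℝ)) (cellCenter J k) x = 0 ∨ bump (1 / (J : ℝ)) (cellCenter J k') x = 0 := by
  by_contra! hcon
  have hJ' : (0 : ℝ) < J := by exact_mod_cast hJ
  obtain ⟨i, hi⟩ := Function.ne_iff.1 hk
  have hb : ∀ k : Fin d → Fin J, bump (1 / (J : ℝ)) (cellCenter J k) x ≠ 0 →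
      |x i - cellCenter J k i| < 1 / J / 2 := by
    intro k hk
    have hx : x ∈ supBall (cellCenter J k) (1 / (J : ℝ) / 2) := by
      by_contra h; exact hk (bump_eq_zero h)
    rw [supBall, Set.mem_preimage, mem_ball_iff_norm] at hx
    exact (norm_le_pi_norm (x.ofLp - cellCenter J k) i).trans_lt hx
  have h1 := abs_lt.1 (hb k hcon.1)
  have h2 := abs_lt.1 (hb k' hcon.2)
  simp only [cellCenter] at h1 h2
  have key : ∀ a b : ℕ, a + 1 ≤ b → ((a : ℝ) + 1 / 2) / J + 1 / J ≤ ((b : ℝ) + 1 / 2) / J := by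
    intro a b hab
    rw [← add_div]
    have : (a : ℝ) + 1 ≤ b := by exact_mod_cast hab
    exact div_le_div_of_nonneg_right (by linarith) hJ'.le
  have hne : (k i : ℕ) ≠ (k' i : ℕ) := fun h => hi (Fin.ext h)
  rcases Nat.lt_or_gt_of_ne hne with h | h
  · linarith [key _ _ h]
  · linarith [key _ _ h]

/-- A sum of signed functions with disjoint supports, each of which is `1`-Lipschitz and small. -/
theorem abs_sum_le_of_disjoint {K α : Type*} [Fintype K] (φ : K → α → ℝ) {b : ℝ} (hb : 0 ≤ b)
    (hφ : ∀ k x, 0 ≤ φ k x ∧ φ k x ≤ b) (hφd : ∀ x k k', k ≠ k' → φ k x = 0 ∨ φ k' x = 0)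
    (σ : K → Bool) (x : α) : |∑ k, sgn (σ k) * φ k x / 8| ≤ b / 8 := by
  have hs : ∀ b, |sgn b| = 1 := fun b => by cases b <;> simp [sgn]
  by_cases h : ∃ k, φ k x ≠ 0
  · obtain ⟨k, hk⟩ := h
    rw [Finset.sum_eq_single k (fun k' _ hne => by
      rcases hφd x k' k hne with h | h
      · simp [h]
      · exact absurd h hk) (by simp), abs_div, abs_mul, hs, abs_of_nonneg (hφ k x).1]
    norm_num
    linarith [(hφ k x).2]
  · push Not at h
    simp only [h]
    simp
    positivity

/-- At most one term is nonzero at `x` and at most one at `y`, so at most two terms, each bounded by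
`r / 8`, contribute. -/
theorem abs_sum_sub_sum_le_of_disjoint {K α : Type*} [Fintype K] [DecidableEq K] (φ : K → α → ℝ)
    (hφd : ∀ x k k', k ≠ k' → φ k x = 0 ∨ φ k' x = 0)
    (σ : K → Bool) (x y : α) {r : ℝ} (hr : ∀ k, |φ k x - φ k y| ≤ r) (hr0 : 0 ≤ r) :
    |∑ k, sgn (σ k) * φ k x / 8 - ∑ k, sgn (σ k) * φ k y / 8| ≤ r / 4 := by
  have hs : ∀ b, |sgn b| = 1 := fun b => by cases b <;> simp [sgn]
  rw [← Finset.sum_sub_distrib]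
  have hterm : ∀ k, |sgn (σ k) * φ k x / 8 - sgn (σ k) * φ k y / 8| ≤ r / 8 := fun k => by
    rw [← sub_div, ← mul_sub, abs_div, abs_mul, hs]
    norm_num
    linarith [hr k]
  set s : Finset K := Finset.univ.filter fun k => φ k x ≠ 0 ∨ φ k y ≠ 0 with hsdef
  have hcard1 : ∀ z, (Finset.univ.filter fun k => φ k z ≠ 0).card ≤ 1 := fun z =>
    Finset.card_le_one.2 fun k hk k' hk' => by
      by_contra hne
      simp only [Finset.mem_filter, Finset.mem_univ, true_and] at hk hk'
      exact (hφd z k k' hne).elim hk hk'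
  have hcard : s.card ≤ 2 := by
    rw [hsdef, Finset.filter_or]
    exact (Finset.card_union_le _ _).trans (by linarith [hcard1 x, hcard1 y])
  rw [← Finset.sum_subset (Finset.subset_univ s) fun k _ hk => by
    simp only [hsdef, Finset.mem_filter, Finset.mem_univ, true_and, not_or, not_not] at hk
    simp [hk.1, hk.2]]
  refine (Finset.abs_sum_le_sum_abs _ _).trans ((Finset.sum_le_card_nsmul s _ _
    fun k _ => hterm k).trans ?_)
  rw [nsmul_eq_mul]
  have : (s.card : ℝ) ≤ 2 := by exact_mod_cast hcard
  nlinarith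

end Geometry

/-! ### Quadratic demand models -/

section Quadratic

variable {d : ℕ} {Y : Set ℝ}

/-- The demand whose revenue is `3/8 - (p - 3/4)^2 + g x (p - 3/4)`. -/
def quadDemand (g : Ctx d → ℝ) (p : ℝ) (x : Ctx d) : ℝ :=
  (3 / 8 - (p - 3 / 4) ^ 2 + g x * (p - 3 / 4)) / p

/-- The base level `3/8` leaves room on both sides: the revenue stays nonnegative and below `1/2 ≤
p`. -/
theorem quadDemand_mem {g : Ctx d → ℝ} (hgb : ∀ x, |g x| ≤ 1 / 16) {p : ℝ}
    (hp : p ∈ Set.Icc (1 / 2 : ℝ) 1) (x : Ctx d) : quadDemand g p x ∈ Set.Icc (0 : ℝ) 1 := by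
  have h := abs_le.1 (hgb x)
  have hp0 : 0 < p := by linarith [hp.1]
  have h1 : |g x * (p - 3 / 4)| ≤ 1 / 16 * (1 / 4) := by
    rw [abs_mul]
    exact mul_le_mul (hgb x) (abs_le.2 ⟨by linarith [hp.1], by linarith [hp.2]⟩) (abs_nonneg _)
      (by norm_num)
  have h2 := abs_le.1 h1
  have h3 : (p - 3 / 4) ^ 2 ≤ 1 / 16 := by nlinarith [hp.1, hp.2]
  constructor
  · exact div_nonneg (by linarith) hp0.le
  · rw [quadDemand, div_le_one hp0]
    nlinarith [hp.1, sq_nonneg (p - 3 / 4)]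

theorem mul_quadDemand (g : Ctx d → ℝ) {p : ℝ} (hp : p ≠ 0) (x : Ctx d) :
    p * quadDemand g p x = 3 / 8 - (p - 3 / 4) ^ 2 + g x * (p - 3 / 4) := by
  rw [quadDemand]; field_simp

theorem measurable_quadDemand {g : Ctx d → ℝ} (hg : Measurable g) :
    Measurable fun q : unitCube d × Set.Icc (1 / 2 : ℝ) 1 => quadDemand g q.2 q.1 := by
  unfold quadDemand
  fun_prop

/-- Bernoulli demands with mean `quadDemand g`. -/
def quadKernel (hY : {0, 1} ⊆ Y) {g : Ctx d → ℝ} (hg : Measurable g) :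
    Kernel (unitCube d × Set.Icc (1 / 2 : ℝ) 1) Y where
  toFun q := ENNReal.ofReal (quadDemand g q.2 q.1) • Measure.dirac (⟨1, hY (by simp)⟩ : Y) +
    ENNReal.ofReal (1 - quadDemand g q.2 q.1) • Measure.dirac (⟨0, hY (by simp)⟩ : Y)
  measurable' := by
    have h := measurable_quadDemand hg
    refine Measure.measurable_of_measurable_coe _ fun s _ => ?_
    simp only [Measure.coe_add, Measure.coe_smul, Pi.add_apply, Pi.smul_apply, smul_eq_mul]
    exact (h.ennreal_ofReal.mul_const _).add ((h.const_sub 1).ennreal_ofReal.mul_const _)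

theorem isTwoPoint_quadKernel (hY : {0, 1} ⊆ Y) {g : Ctx d → ℝ} (hg : Measurable g)
    (hgb : ∀ x, |g x| ≤ 1 / 16) :
    IsTwoPoint (quadKernel hY hg) ⟨0, hY (by simp)⟩ ⟨1, hY (by simp)⟩
      fun q => quadDemand g q.2 q.1 :=
  ⟨measurable_quadDemand hg, fun q => quadDemand_mem hgb q.2.2 _, fun _ => rfl⟩

theorem isMarkovKernel_quadKernel (hY : {0, 1} ⊆ Y) {g : Ctx d → ℝ} (hg : Measurable g)
    (hgb : ∀ x, |g x| ≤ 1 / 16) : IsMarkovKernel (quadKernel hY hg) := by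
  refine ⟨fun q => ⟨?_⟩⟩
  obtain ⟨h0, h1⟩ := quadDemand_mem hgb q.2.2 q.1
  rw [(isTwoPoint_quadKernel hY hg hgb).eq q]
  simp only [Measure.coe_add, Measure.coe_smul, Pi.add_apply, Pi.smul_apply, smul_eq_mul,
    measure_univ, mul_one]
  rw [← ENNReal.ofReal_add h0 (by linarith)]
  simp

/-- The demand model with quadratic revenue `3/8 - (p - 3/4)^2 + g x (p - 3/4)`. -/
def quadModel (hY : {0, 1} ⊆ Y) {g : Ctx d → ℝ} (hg : Measurable g)
    (hgb : ∀ x, |g x| ≤ 1 / 16) : DemandModel (unitCube d) Y (1 / 2) 1 where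
  lam := quadDemand g
  D := quadKernel hY hg
  markovD := isMarkovKernel_quadKernel hY hg hgb
  mean_eq x p := by
    obtain ⟨h0, h1⟩ := quadDemand_mem hgb p.2 x
    have hm : StronglyMeasurable fun y : Y => (y : ℝ) := measurable_subtype_coe.stronglyMeasurable
    have hi : ∀ (y : Y) (r : ℝ), Integrable (fun y : Y => (y : ℝ))
        (ENNReal.ofReal r • Measure.dirac y) := fun y r =>
      ((integrable_dirac' hm (by simp)).smul_measure ENNReal.ofReal_ne_top)
    rw [(isTwoPoint_quadKernel hY hg hgb).eq, integral_add_measure (hi _ _) (hi _ _),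
      integral_smul_measure, integral_smul_measure, integral_dirac' _ _ hm, integral_dirac' _ _ hm]
    simp [ENNReal.toReal_ofReal h0]

/-- The optimal price in the quadratic model. -/
def quadPrice (g : Ctx d → ℝ) (x : Ctx d) : ℝ := 3 / 4 + g x / 2

variable (hY : {0, 1} ⊆ Y) {g : Ctx d → ℝ} (hg : Measurable g) (hgb : ∀ x, |g x| ≤ 1 / 16)

theorem quadPrice_mem (hgb : ∀ x, |g x| ≤ 1 / 16) (x : Ctx d) :
    quadPrice g x ∈ Set.Icc (1 / 2 : ℝ) 1 := by
  have := abs_le.1 (hgb x)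
  unfold quadPrice
  constructor <;> linarith

theorem quadModel_rev {p : ℝ} (hp : p ≠ 0) (x : Ctx d) :
    (quadModel hY hg hgb).rev p x = 3 / 8 - (p - 3 / 4) ^ 2 + g x * (p - 3 / 4) :=
  mul_quadDemand g hp x

/-- Completing the square, the loss is exactly the squared distance to the optimal price. -/
theorem quadModel_rev_sub {p : ℝ} (hp : p ≠ 0) (x : Ctx d) :
    (quadModel hY hg hgb).rev (quadPrice g x) x - (quadModel hY hg hgb).rev p x =
      (p - 3 / 4 - g x / 2) ^ 2 := by
  have : quadPrice g x ≠ 0 := by linarith [(quadPrice_mem hgb x).1]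
  rw [quadModel_rev hY hg hgb hp, quadModel_rev hY hg hgb this, quadPrice]
  ring

theorem quadModel_isOptimalPrice : (quadModel hY hg hgb).IsOptimalPrice (quadPrice g) := by
  intro x _
  refine ⟨quadPrice_mem hgb x, fun p hp => ?_⟩
  have := quadModel_rev_sub hY hg hgb (show p ≠ 0 by linarith [hp.1]) x
  change (quadModel hY hg hgb).rev p x ≤ (quadModel hY hg hgb).rev (quadPrice g x) x
  nlinarith [sq_nonneg (p - 3 / 4 - g x / 2)]

theorem assumptionA1_unitCube (hY' : Y ⊆ Set.Icc 0 1) :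
    AssumptionA1 (unitCube d) Y (1 / 2) 1 (uniformCube d) 1 :=
  ⟨subset_rfl, hY', Set.Icc_subset_Icc (by norm_num) le_rfl, isProbabilityMeasure_uniformCube,
    fun _ => 1, measurable_const, by simp [uniformCube], by simp⟩

theorem quadModel_assumptionA2 (hgl : ∀ x y, |g x - g y| ≤ ‖x - y‖) :
    (quadModel hY hg hgb).AssumptionA2 4 := by
  intro p hp p' hp' x _ x' _
  rw [quadModel_rev hY hg hgb (by linarith [hp.1]), quadModel_rev hY hg hgb (by linarith [hp'.1])]
  have e : 3 / 8 - (p - 3 / 4) ^ 2 + g x * (p - 3 / 4) -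
      (3 / 8 - (p' - 3 / 4) ^ 2 + g x' * (p' - 3 / 4)) =
      (g x - (p + p' - 3 / 2)) * (p - p') + (p' - 3 / 4) * (g x - g x') := by ring
  rw [e]
  have h1 : |g x - (p + p' - 3 / 2)| ≤ 4 := by
    have := abs_le.1 (hgb x)
    exact abs_le.2 ⟨by linarith [hp.2, hp'.2], by linarith [hp.1, hp'.1]⟩
  have h2 : |p' - 3 / 4| ≤ 4 := abs_le.2 ⟨by linarith [hp'.1], by linarith [hp'.2]⟩
  calc _ ≤ |g x - (p + p' - 3 / 2)| * |p - p'| + |p' - 3 / 4| * |g x - g x'| := by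
        rw [← abs_mul, ← abs_mul]; exact abs_add_le _ _
    _ ≤ 4 * |p - p'| + 4 * ‖x - x'‖ := by
        have := hgl x x'
        gcongr
    _ = _ := by ring

/-- Revenue is affine in `g x`, so averaging over `B` gives the same quadratic with `g` replaced by
its mean; (A3) then reduces to facts about that mean. -/
theorem quadModel_avgRev (B : Set (Ctx d)) (hB : uniformCube d B ≠ 0) {p : ℝ} (hp : p ≠ 0) :
    (quadModel hY hg hgb).avgRev (uniformCube d) B p =
      3 / 8 - (p - 3 / 4) ^ 2 + (∫ x, g x ∂(uniformCube d)[|B]) * (p - 3 / 4) := by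
  have := isProbabilityMeasure_uniformCube (d := d)
  have := cond_isProbabilityMeasure hB
  rw [DemandModel.avgRev]
  simp only [quadModel_rev hY hg hgb hp]
  rw [integral_add (integrable_const _) ((integrable_of_abs_le _ hg hgb).mul_const _),
    integral_mul_const]
  simp

theorem quadModel_assumptionA3 (hgl : ∀ x y, |g x - g y| ≤ ‖x - y‖) :
    (quadModel hY hg hgb).AssumptionA3 (uniformCube d) (quadPrice g) (Real.sqrt 2) 2 1 := by
  refine ⟨by positivity, ?_, fun a l _ hsub hB => ?_⟩
  · rw [Real.sqrt_le_left (by norm_num)]; norm_num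
  have := isProbabilityMeasure_uniformCube (d := d)
  have := cond_isProbabilityMeasure hB
  set B := hypercube a l with hBdef
  set f := (quadModel hY hg hgb).avgRev (uniformCube d) B with hf
  set m := ∫ x, g x ∂(uniformCube d)[|B] with hm
  have hBm : MeasurableSet B := by
    have : B = ⋂ i, (fun x : Ctx d => x i) ⁻¹' Set.Icc (a i) (a i + l) := by
      ext x; simp [hBdef, hypercube]
    rw [this]
    exact MeasurableSet.iInter fun i => measurableSet_Icc.preimage (by fun_prop)
  have hBne : B.Nonempty := by
    rw [Set.nonempty_iff_ne_empty]
    intro h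
    exact hB (by rw [h]; simp)
  have hgi := integrable_of_abs_le (uniformCube d)[|B] hg hgb
  have hmem : ∀ᵐ x ∂(uniformCube d)[|B], x ∈ B := ae_cond_mem hBm
  have hfp : ∀ p, p ≠ 0 → f p = 3 / 8 - (p - 3 / 4) ^ 2 + m * (p - 3 / 4) := fun p hp =>
    quadModel_avgRev hY hg hgb B hB hp
  have hmge : ∀ c, (∀ x ∈ B, c ≤ g x) → c ≤ m := fun c hc => by
    have := integral_mono_ae (integrable_const c) hgi (hmem.mono fun x hx => hc x hx)
    simpa using this
  have hmle : ∀ c, (∀ x ∈ B, g x ≤ c) → m ≤ c := fun c hc => by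
    have := integral_mono_ae hgi (integrable_const c) (hmem.mono fun x hx => hc x hx)
    simpa using this
  have hm1 : -(1 / 16) ≤ m := hmge _ fun x _ => (abs_le.1 (hgb x)).1
  have hm2 : m ≤ 1 / 16 := hmle _ fun x _ => (abs_le.1 (hgb x)).2
  have hbb : BddBelow (quadPrice g '' B) := ⟨1 / 2, by
    rintro _ ⟨x, _, rfl⟩; exact (quadPrice_mem hgb x).1⟩
  have hba : BddAbove (quadPrice g '' B) := ⟨1, by
    rintro _ ⟨x, _, rfl⟩; exact (quadPrice_mem hgb x).2⟩
  have hquad : ∀ p, deriv (fun p : ℝ => 3 / 8 - (p - 3 / 4) ^ 2 + m * (p - 3 / 4)) p =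
      -2 * (p - 3 / 4) + m := by
    intro p
    have h1 : HasDerivAt (fun p : ℝ => p - 3 / 4) 1 p := (hasDerivAt_id p).sub_const _
    have h2 := ((h1.pow 2).const_sub (3 / 8)).add (h1.const_mul m)
    have h3 := h2.deriv
    refine Eq.trans h3 ?_
    simp
  have hderiv2 : ∀ p ∈ Set.Ioo (1 / 2 : ℝ) 1, iteratedDeriv 2 f p = -2 := by
    intro p hp
    -- `quadDemand` divides by `p`, so the formula is only available for `p ≠ 0`; near an interior
    -- price this suffices.
    have hev : f =ᶠ[nhds p] fun p : ℝ => 3 / 8 - (p - 3 / 4) ^ 2 + m * (p - 3 / 4) := by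
      filter_upwards [isOpen_Ioo.mem_nhds hp] with q hq
      exact hfp q (by linarith [hq.1])
    rw [hev.iteratedDeriv_eq 2, iteratedDeriv_succ, iteratedDeriv_one, funext hquad]
    have h1 : HasDerivAt (fun p : ℝ => p - 3 / 4) 1 p := (hasDerivAt_id p).sub_const _
    have h2 := (h1.const_mul (-2)).add_const m
    refine Eq.trans h2.deriv ?_
    norm_num
  have hs : Real.sqrt 2 ^ 2 = 2 := Real.sq_sqrt (by norm_num)
  -- The maximizer is the mean of `quadPrice g` over `B`, hence lies between its infimum and
  -- supremum.
  refine ⟨3 / 4 + m / 2, ⟨by linarith, by linarith⟩, fun p hp => ?_, ?_, fun p hp => ?_, ?_, ?_, ?_⟩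
  · change f p ≤ f (3 / 4 + m / 2)
    rw [hfp p (by linarith [hp.1]), hfp _ (by linarith)]
    nlinarith [sq_nonneg (p - 3 / 4 - m / 2)]
  · refine ContDiffOn.congr (f := fun p : ℝ => 3 / 8 - (p - 3 / 4) ^ 2 + m * (p - 3 / 4)) ?_
      fun p hp => hfp p (by linarith [hp.1])
    exact ContDiff.contDiffOn (by fun_prop)
  · rw [hderiv2 p hp, hs]; norm_num
  · have := hmge (2 * (sInf (quadPrice g '' B) - 3 / 4)) fun x hx => by
      have := csInf_le hbb (Set.mem_image_of_mem (quadPrice g) hx)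
      rw [quadPrice] at this; linarith
    linarith
  · have := hmle (2 * (sSup (quadPrice g '' B) - 3 / 4)) fun x hx => by
      have := le_csSup hba (Set.mem_image_of_mem (quadPrice g) hx)
      rw [quadPrice] at this; linarith
    linarith
  · have hbd : Bornology.IsBounded B := isBounded_unitCube.subset hsub
    have h1 : ∀ x ∈ B, ∀ y ∈ B, quadPrice g x ≤ quadPrice g y + Metric.diam B := by
      intro x hx y hy
      have h2 := Metric.dist_le_diam_of_mem hbd hx hy
      rw [dist_eq_norm] at h2
      have h3 := (abs_le.1 (hgl x y)).2
      have h4 : 0 ≤ ‖x - y‖ := norm_nonneg _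
      unfold quadPrice
      linarith
    have h2 : sSup (quadPrice g '' B) - Metric.diam B ≤ sInf (quadPrice g '' B) := by
      refine le_csInf (hBne.image _) ?_
      rintro _ ⟨y, hy, rfl⟩
      have : sSup (quadPrice g '' B) ≤ quadPrice g y + Metric.diam B := by
        refine csSup_le (hBne.image _) ?_
        rintro _ ⟨x, hx, rfl⟩
        exact h1 x hx y hy
      linarith
    linarith

theorem quadModel_regret {𝒵 : Type*} [MeasurableSpace 𝒵]
    (π : PricingPolicy (unitCube d) Y (Set.Icc (1 / 2 : ℝ) 1) 𝒵) (T : ℕ)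
    [IsProbabilityMeasure ((uniformCube d).comap (Subtype.val : unitCube d → Ctx d))] :
    (quadModel hY hg hgb).regret (uniformCube d) (quadPrice g) π T =
      ∫ q, ((q.2 : ℝ) - 3 / 4 - g q.1 / 2) ^ 2
        ∂(π.occupation ((uniformCube d).comap Subtype.val) (quadKernel hY hg) T) := by
  have := isMarkovKernel_quadKernel hY hg hgb
  have hF : Measurable fun q : unitCube d × Set.Icc (1 / 2 : ℝ) 1 =>
    ((q.2 : ℝ) - 3 / 4 - g q.1 / 2) ^ 2 := by fun_prop
  have hC : ∀ q : unitCube d × Set.Icc (1 / 2 : ℝ) 1,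
      |((q.2 : ℝ) - 3 / 4 - g q.1 / 2) ^ 2| ≤ 1 := by
    intro q
    rw [abs_of_nonneg (sq_nonneg _)]
    have h1 := abs_le.1 (hgb q.1)
    have h2 := q.2.2
    nlinarith [h2.1, h2.2]
  rw [integral_occupation π _ _ hF hC, ← integral_law_sum π _ _ hF hC, DemandModel.regret]
  refine integral_congr_ae (ae_of_all _ fun ω => Finset.sum_congr rfl fun t _ => ?_)
  exact quadModel_rev_sub hY hg hgb (by linarith [(ω t).1.2.2.2.1]) _

end Quadratic

/-! ### Uniform contexts on the subtype, choice of the grid and the rate -/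

theorem isProbabilityMeasure_comap_uniformCube (d : ℕ) :
    IsProbabilityMeasure ((uniformCube d).comap (Subtype.val : unitCube d → Ctx d)) := by
  refine ⟨?_⟩
  rw [(MeasurableEmbedding.subtype_coe measurableSet_unitCube).comap_apply, Set.image_univ,
    Subtype.range_coe, uniformCube, Measure.restrict_apply_self, volume_unitCube]

theorem integral_comap_uniformCube {d : ℕ} (f : Ctx d → ℝ) :
    ∫ x, f x ∂((uniformCube d).comap (Subtype.val : unitCube d → Ctx d)) =
      ∫ x, f x ∂(uniformCube d) := by
  rw [integral_subtype_comap measurableSet_unitCube, uniformCube, Measure.restrict_restrict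
    measurableSet_unitCube, Set.inter_self]

theorem sum_sgn_update_sub {K : Type*} [Fintype K] [DecidableEq K] (σ : K → Bool) (k : K)
    (a : K → ℝ) : ∑ j, sgn (Function.update σ k (!σ k) j) * a j / 8 - ∑ j, sgn (σ j) * a j / 8 =
      -(sgn (σ k) * a k / 4) := by
  rw [← Finset.sum_sub_distrib, Finset.sum_eq_single k (fun j _ hj => by
    rw [Function.update_of_ne hj]; ring) (by simp)]
  rw [Function.update_self]
  cases σ k <;> simp [sgn] <;> ring

/-- The mesh `1 / J` of the grid is of order `y⁻¹` for `y = (ε² T) ^ (1 / (2 (d + 2)))`. -/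
theorem exists_grid (d : ℕ) {X : ℝ} (hX : 1 ≤ X) :
    ∃ J : ℕ, 0 < J ∧ X ≤ (J : ℝ) ^ (2 * (d + 2)) ∧
      X ^ (-(1 / ((d : ℝ) + 2))) / 4 ≤ (1 / (J : ℝ)) ^ 2 := by
  have hX0 : 0 ≤ X := by linarith
  set y := X ^ (1 / (2 * ((d : ℝ) + 2))) with hy
  have hy1 : 1 ≤ y := Real.one_le_rpow hX (by positivity)
  have hle : y ≤ ⌈y⌉₊ := Nat.le_ceil y
  have hJ0 : 0 < ⌈y⌉₊ := Nat.ceil_pos.2 (by linarith)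
  -- Rounding up at most doubles `y` because `y ≥ 1`; this is the source of the factor `1 / 4` in
  -- the conclusion.
  have hJ2 : (⌈y⌉₊ : ℝ) ≤ 2 * y := by linarith [Nat.ceil_lt_add_one (show 0 ≤ y by linarith)]
  have hJ' : (0 : ℝ) < ⌈y⌉₊ := by exact_mod_cast hJ0
  have hpow : y ^ (2 * (d + 2)) = X := by
    rw [hy, ← Real.rpow_natCast, ← Real.rpow_mul hX0]
    have : 1 / (2 * ((d : ℝ) + 2)) * ((2 * (d + 2) : ℕ) : ℝ) = 1 := by
      push_cast; field_simp
    rw [this, Real.rpow_one]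
  have hsq : y ^ 2 = X ^ (1 / ((d : ℝ) + 2)) := by
    rw [hy, ← Real.rpow_natCast, ← Real.rpow_mul hX0]
    congr 1
    push_cast; field_simp
  refine ⟨⌈y⌉₊, hJ0, ?_, ?_⟩
  · rw [← hpow]
    exact pow_le_pow_left₀ (by linarith) hle _
  · rw [Real.rpow_neg hX0, ← hsq, div_pow, one_pow, inv_eq_one_div, div_div]
    refine one_div_le_one_div_of_le (by positivity) ?_
    nlinarith

theorem rate_eq (d : ℕ) {ε T : ℝ} (hε : 0 < ε) (hT : 0 < T) :
    ε ^ (-(2 / ((d : ℝ) + 2))) * T ^ (((d : ℝ) + 1) / ((d : ℝ) + 2)) =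
      T * (ε ^ 2 * T) ^ (-(1 / ((d : ℝ) + 2))) := by
  have h1 : ((d : ℝ) + 1) / ((d : ℝ) + 2) = 1 + -(1 / ((d : ℝ) + 2)) := by
    field_simp; ring
  have h2 : -(2 / ((d : ℝ) + 2)) = ((2 : ℕ) : ℝ) * -(1 / ((d : ℝ) + 2)) := by
    push_cast; ring
  rw [h1, Real.rpow_add hT, Real.rpow_one, Real.mul_rpow (by positivity) hT.le, h2,
    Real.rpow_mul hε.le, Real.rpow_natCast]
  ring

/-- The rate of the lower bound in terms of the number of cells and the mass of a bump. -/
theorem rate_le {d J : ℕ} (hd : 1 ≤ d) {ε T : ℝ} (hε : 0 < ε) (hT : 0 < T) (hJ : 0 < J)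
    (h : (ε ^ 2 * T) ^ (-(1 / ((d : ℝ) + 2))) / 4 ≤ (1 / (J : ℝ)) ^ 2) :
    1 / 200000 * (ε ^ (-(2 / ((d : ℝ) + 2))) * T ^ (((d : ℝ) + 1) / ((d : ℝ) + 2)) /
        (d : ℝ) ^ ((7 : ℝ) / 3)) ≤
      ((J ^ d : ℕ) : ℝ) * (T * ((1 / (J : ℝ)) ^ (d + 2) / (32 * d ^ 2))) / 1000 := by
  have hd' : (1 : ℝ) ≤ d := by exact_mod_cast hd
  have hJ' : (0 : ℝ) < J := by exact_mod_cast hJ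
  -- The construction loses only `d ^ 2`, which is at most `d ^ (7/3)`.
  have hdp : (d : ℝ) ^ 2 ≤ (d : ℝ) ^ ((7 : ℝ) / 3) := by
    rw [← Real.rpow_natCast]
    exact Real.rpow_le_rpow_of_exponent_le hd' (by norm_num)
  rw [rate_eq d hε hT]
  set A := (ε ^ 2 * T) ^ (-(1 / ((d : ℝ) + 2))) with hA
  have hA0 : 0 ≤ A := by positivity
  have e : ((J ^ d : ℕ) : ℝ) * (T * ((1 / (J : ℝ)) ^ (d + 2) / (32 * d ^ 2))) / 1000 =
      T * (1 / (J : ℝ)) ^ 2 / (32000 * d ^ 2) := by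
    push_cast
    rw [pow_add]
    rw [one_div, inv_pow, inv_pow]
    field_simp
    norm_num
  rw [e]
  -- The constant suffices since `4 * 32000 = 128000 ≤ 200000`.
  calc 1 / 200000 * (T * A / (d : ℝ) ^ ((7 : ℝ) / 3)) ≤ 1 / 200000 * (T * A / (d : ℝ) ^ 2) := by
        gcongr
    _ ≤ T * (A / 4) / (32000 * d ^ 2) := by
        rw [div_mul_div_comm, div_le_div_iff₀ (by positivity) (by positivity)]
        have : 0 ≤ T * A * (d : ℝ) ^ 2 := by positivity
        nlinarith
    _ ≤ _ := by gcongr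

end PrivatePricing

end

/-! ### The lower bound -/

theorem theorem3 :
    ∃ c C₀ lo hi : ℝ, 0 < c ∧ 0 < C₀ ∧ 0 ≤ lo ∧ lo < hi ∧ hi ≤ 1 ∧
      ∀ (d : ℕ) (hd : 1 ≤ d) (ε : ℝ) (hε : 0 < ε) (hε' : ε ≤ 1) (T : ℕ)
        (hT : C₀ * (ε⁻¹ * (d : ℝ) ^ ((d : ℝ) / 2 + 1) * Real.log ((d : ℝ) / ε)) ≤ (T : ℝ))
        (hT' : 1 / ε ^ 2 ≤ (T : ℝ))
        (Y : Set ℝ) (hY : {0, 1} ⊆ Y) (hY' : Y ⊆ Set.Icc 0 1)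
        (𝒵 : Type*) [MeasurableSpace 𝒵]
        (π : PrivatePricing.PricingPolicy (PrivatePricing.unitCube d) Y (Set.Icc lo hi) 𝒵)
        (hπ : π.IsLDP T ε),
        ∃ (M : PrivatePricing.DemandModel (PrivatePricing.unitCube d) Y lo hi)
          (pstar : PrivatePricing.Ctx d → ℝ),
          M.IsOptimalPrice pstar ∧
          PrivatePricing.AssumptionA1 (PrivatePricing.unitCube d) Y lo hi
            (PrivatePricing.uniformCube d) 1 ∧
          M.AssumptionA2 4 ∧
          M.AssumptionA3 (PrivatePricing.uniformCube d) pstar (Real.sqrt 2) 2 1 ∧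
          c * (ε ^ (-(2 / ((d : ℝ) + 2))) * (T : ℝ) ^ (((d : ℝ) + 1) / ((d : ℝ) + 2)) /
              (d : ℝ) ^ ((7 : ℝ) / 3)) ≤
            M.regret (PrivatePricing.uniformCube d) pstar π T := by
  refine ⟨1 / 200000, 1, 1 / 2, 1, by norm_num, by norm_num, by norm_num, by norm_num, le_rfl, ?_⟩
  intro d hd ε hε hε' T _ hT' Y hY hY' 𝒵 _ π hπ
  have hX : 1 ≤ ε ^ 2 * T := by
    rw [div_le_iff₀ (by positivity)] at hT'
    linarith
  have hT0 : (0 : ℝ) < T := lt_of_lt_of_le (by positivity) hT'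
  obtain ⟨J, hJ, hJX, hJr⟩ := PrivatePricing.exists_grid d hX
  have hJ' : (0 : ℝ) < J := by exact_mod_cast hJ
  have hh : 0 < 1 / (J : ℝ) := by positivity
  have hh1 : 1 / (J : ℝ) ≤ 1 := by
    rw [div_le_one hJ']; exact_mod_cast hJ
  set φ : (Fin d → Fin J) → PrivatePricing.Ctx d → ℝ :=
    fun k => PrivatePricing.bump (1 / (J : ℝ)) (PrivatePricing.cellCenter J k)
  have hφm : ∀ k, Measurable (φ k) := fun k => PrivatePricing.measurable_bump _ _
  have hφb : ∀ k x, 0 ≤ φ k x ∧ φ k x ≤ 1 / 2 := fun k x =>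
    ⟨PrivatePricing.bump_nonneg _ _ _, (PrivatePricing.bump_le hh.le _ _).trans (by linarith)⟩
  have hφd : ∀ x k k', k ≠ k' → φ k x = 0 ∨ φ k' x = 0 := fun x k k' hk =>
    PrivatePricing.bump_disjoint hJ hk x
  set g : ((Fin d → Fin J) → Bool) → PrivatePricing.Ctx d → ℝ :=
    fun σ x => ∑ k, PrivatePricing.sgn (σ k) * φ k x / 8
  have hgm : ∀ σ, Measurable (g σ) := fun σ =>
    Finset.measurable_fun_sum _ fun k _ => ((hφm k).const_mul _).div_const _
  have hgb : ∀ σ x, |g σ x| ≤ 1 / 16 := fun σ x =>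
    (PrivatePricing.abs_sum_le_of_disjoint φ (by norm_num) hφb hφd σ x).trans (by norm_num)
  have hgl : ∀ σ x y, |g σ x - g σ y| ≤ ‖x - y‖ := fun σ x y =>
    (PrivatePricing.abs_sum_sub_sum_le_of_disjoint φ hφd σ x y
      (fun k => PrivatePricing.abs_bump_sub_le _ _ x y) (norm_nonneg _)).trans
      (by linarith [norm_nonneg (x - y)])
  have hprob := PrivatePricing.isProbabilityMeasure_comap_uniformCube d
  have hmk : ∀ σ, IsMarkovKernel (PrivatePricing.quadKernel hY (hgm σ)) := fun σ =>
    PrivatePricing.isMarkovKernel_quadKernel hY (hgm σ) (hgb σ)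
  have hint : ∀ k, ∫ x, φ k x ^ 2 ∂((PrivatePricing.uniformCube d).comap
      (Subtype.val : PrivatePricing.unitCube d → PrivatePricing.Ctx d)) =
      ∫ x, φ k x ^ 2 ∂(PrivatePricing.uniformCube d) := fun k =>
    PrivatePricing.integral_comap_uniformCube fun x => φ k x ^ 2
  obtain ⟨σ, hσ⟩ := PrivatePricing.exists_le_integral_occupation π
    ((PrivatePricing.uniformCube d).comap Subtype.val) hε hε' hπ
    (fun σ => PrivatePricing.quadKernel hY (hgm σ))
    (fun σ => PrivatePricing.isTwoPoint_quadKernel hY (hgm σ) (hgb σ))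
    (φ := fun k x => φ k x) (fun k => (hφm k).comp measurable_subtype_coe)
    (fun k x => hφb k x) (fun x => hφd x) (u := fun p => (p : ℝ) - 3 / 4) (by fun_prop)
    (fun p => abs_le.2 ⟨by linarith [p.2.1], by linarith [p.2.2]⟩)
    -- Flipping a sign changes `g` by `φ k / 4` in absolute value; dividing by `p ≥ 1/2` turns `1/4`
    -- into `1/2`.
    (fun σ k q => by
      have hp : (0 : ℝ) < q.2 := by linarith [q.2.2.1]
      have e : PrivatePricing.quadDemand (g (Function.update σ k (!σ k))) q.2 q.1 -
          PrivatePricing.quadDemand (g σ) q.2 q.1 =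
          -(PrivatePricing.sgn (σ k) * φ k q.1 / 4) * ((q.2 : ℝ) - 3 / 4) / q.2 := by
        rw [← PrivatePricing.sum_sgn_update_sub σ k fun j => φ j q.1]
        simp only [PrivatePricing.quadDemand, g]
        ring
      have hs : |PrivatePricing.sgn (σ k)| = 1 := by cases σ k <;> simp [PrivatePricing.sgn]
      rw [e, abs_div, abs_mul, abs_neg, abs_div, abs_mul, hs, abs_of_nonneg (hφb k q.1).1,
        abs_of_pos hp, div_le_iff₀ hp, abs_of_pos (by norm_num : (0 : ℝ) < 4)]
      have h0 : 0 ≤ φ k q.1 * |(q.2 : ℝ) - 3 / 4| := mul_nonneg (hφb k q.1).1 (abs_nonneg _)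
      nlinarith [q.2.2.1])
    (s := (1 / (J : ℝ)) ^ (d + 2) / (32 * d ^ 2)) (by positivity)
    (fun k => by
      rw [hint k]
      exact PrivatePricing.le_integral_bump_sq hd hh
        (PrivatePricing.supBall_cellCenter_subset hJ k))
    -- The choice of `J` gives `ε² T ≤ J^(2(d+2))`, which cancels `S² ≤ (h^(d+2) / 4)²` up to `1 /
    -- 16`.
    (fun k => by
      rw [hint k]
      have h1 := PrivatePricing.integral_bump_sq_le hh (PrivatePricing.cellCenter J k)
      have h0 : 0 ≤ ∫ x, φ k x ^ 2 ∂(PrivatePricing.uniformCube d) :=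
        integral_nonneg fun x => sq_nonneg _
      calc ε ^ 2 * T * (∫ x, φ k x ^ 2 ∂(PrivatePricing.uniformCube d)) ^ 2
          ≤ (J : ℝ) ^ (2 * (d + 2)) * ((1 / (J : ℝ)) ^ (d + 2) / 4) ^ 2 := by gcongr
        _ = 1 / 16 := by
          rw [div_pow, ← pow_mul, mul_comm (d + 2) 2, one_div, inv_pow]
          field_simp
          norm_num
        _ ≤ 1 := by norm_num)
  refine ⟨PrivatePricing.quadModel hY (hgm σ) (hgb σ), PrivatePricing.quadPrice (g σ),
    PrivatePricing.quadModel_isOptimalPrice hY (hgm σ) (hgb σ),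
    PrivatePricing.assumptionA1_unitCube hY',
    PrivatePricing.quadModel_assumptionA2 hY (hgm σ) (hgb σ) (hgl σ),
    PrivatePricing.quadModel_assumptionA3 hY (hgm σ) (hgb σ) (hgl σ), ?_⟩
  rw [PrivatePricing.quadModel_regret hY (hgm σ) (hgb σ)]
  have hcard : Fintype.card (Fin d → Fin J) = J ^ d := by simp
  rw [hcard] at hσ
  refine (PrivatePricing.rate_le hd hε hT0 hJ hJr).trans (hσ.trans (le_of_eq ?_))
  refine integral_congr_ae (ae_of_all _ fun q => ?_)
  have e : ∑ k, PrivatePricing.sgn (σ k) * φ k q.1 / 16 = g σ q.1 / 2 := by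
    simp only [g]
    rw [Finset.sum_div]
    exact Finset.sum_congr rfl fun k _ => by ring
  dsimp only
  rw [e]
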